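/- For integers $L\ge 1$ and $d,m$, let $f=f_{L,m}$ be the fully connected ReLU network with $L$ hidden layers of width $m$, input $\mathbf{x}\in\mathbb{R}^d$ and scalar output: with $\sigma(z)=\max\{0,z\}$ applied entrywise, $$\alpha^{(0)}(\mathbf{x})=\mathbf{x},\qquad \alpha^{(l)}(\mathbf{x})=\frac{\sqrt2}{\sqrt m}\,\sigma\big(W^{(l)}\alpha^{(l-1)}(\mathbf{x})\big)\ (1\le l\le L),\qquad f(\mathbf{x})=W^{(L+1)}\alpha^{(L)}(\mathbf{x}),$$ where all entries of $W^{(1)}\in\mathbb{R}^{m\times d}$, $W^{(2)},\dots,W^{(L)}\in\mathbb{R}^{m\times m}$, $W^{(L+1)}\in\mathbb{R}^{1\times m}$ are initialized as i.i.d. $\mathcal N(0,1)$ random variables. Given a dataset with two inputs $\mathbf{x}_1,\mathbf{x}_2\in\mathbb{R}^d$, the neural tangent kernel (NTK) matrix at initialization has entries $\langle\nabla f(\mathbf{x}_i),\nabla f(\mathbf{x}_j)\rangle$, $i,j\in\{1,2\}$, where $\nabla$ is the gradient with respect to all the parameters; the NTK matrix $K_L$ of the infinitely wide network of depth $L$ is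 its entrywise limit in probability as $m\to\infty$. Let $G=(\langle\mathbf{x}_i,\mathbf{x}_j\rangle)_{i,j}$ be the Gram matrix, and let the condition number of a positive definite matrix be the ratio of its largest to its smallest eigenvalue. There is an absolute constant $c>0$ such that for every $d$ and all nonzero $\mathbf{x}_1,\mathbf{x}_2\in\mathbb{R}^d$ with angle $\theta_{in}>0$ between them, the following hold. 1. For every $L\ge1$ with $\theta_{in}\le c/L$, the limit $K_L$ exists, $K_L$ and $G$ are positive definite, and their condition numbers $\kappa$ of $K_L$ and $\kappa_0$ of $G$ satisfy $\kappa<\kappa_0$. 2. For all $L_1>L_2\ge1$ with $\theta_{in}\le c/L_1$, the limits $K_{L_1}$ and $K_{L_2}$ exist and are positive definite, and the condition number of $K_{L_1}$ is strictly smaller than that of $K_{L_2}$. -/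

import Mathlib

noncomputable section

namespace DeepReLU

open MeasureTheory ProbabilityTheory Filter Topology

/-- The ReLU activation function `z ↦ max {0, z}`. -/
def relu (z : ℝ) : ℝ := max 0 z

/-- Layer widths: the input layer has `d` neurons, every hidden layer has `m` neurons. -/
def width (d m : ℕ) : ℕ → ℕ
  | 0 => d
  | _ + 1 => m

/-- Index set of all the parameters of a fully connected network with input dimension `d`,
hidden width `m` and `L` hidden layers: the entries of the `L` hidden weight matrices
(the `l`-th one, counted from `0`, has size `width (l + 1) × width l`) and the entries of the
output row vector. -/
abbrev ParamIndex (d m L : ℕ) : Type :=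
  (Σ l : Fin L, Fin (width d m (l + 1)) × Fin (width d m l)) ⊕ Fin (width d m L)

/-- The parameter space. -/
abbrev Params (d m L : ℕ) : Type := EuclideanSpace ℝ (ParamIndex d m L)

/-- The weight matrix from layer `l` to layer `l + 1`, for `l + 1 ≤ L`. -/
def hiddenWeight {d m L : ℕ} (w : Params d m L) (l : Fin L) :
    Matrix (Fin (width d m (l + 1))) (Fin (width d m l)) ℝ :=
  Matrix.of fun i j => w (Sum.inl ⟨l, (i, j)⟩)

/-- The output weights, a single row because the network has one output. -/
def outputWeight {d m L : ℕ} (w : Params d m L) : Fin (width d m L) → ℝ :=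
  fun j => w (Sum.inr j)

/-- The `l`-embedding of the input `x`: `α⁰ = x` and
`αˡ⁺¹ = (√2 / √m) σ(W αˡ)`, with the ReLU `σ` applied entrywise. -/
def embedding {d m L : ℕ} (w : Params d m L) (x : EuclideanSpace ℝ (Fin d)) :
    (l : ℕ) → l ≤ L → (Fin (width d m l) → ℝ)
  | 0, _ => fun i => x i
  | l + 1, h => fun i =>
      Real.sqrt 2 / Real.sqrt m *
        relu ((hiddenWeight w ⟨l, h⟩).mulVec (embedding w x l (Nat.le_of_succ_le h)) i)

/-- The scalar output of the ReLU network with `L` hidden layers of width `m`. -/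
def network {d m L : ℕ} (w : Params d m L) (x : EuclideanSpace ℝ (Fin d)) : ℝ :=
  dotProduct (outputWeight w) (embedding w x L le_rfl)

/-- The model gradient: the gradient of the output with respect to all the parameters. -/
def modelGradient {d m L : ℕ} (w : Params d m L) (x : EuclideanSpace ℝ (Fin d)) :
    Params d m L :=
  gradient (fun v : Params d m L => network v x) w

/-- The neural tangent kernel matrix of a dataset with inputs `x` at the parameters `w`. -/
def ntkMatrix {d m L n : ℕ} (w : Params d m L) (x : Fin n → EuclideanSpace ℝ (Fin d)) :
    Matrix (Fin n) (Fin n) ℝ :=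
  Matrix.of fun i j => inner ℝ (modelGradient w (x i)) (modelGradient w (x j))

/-- The law of the parameters at initialization: all entries i.i.d. standard normal. -/
def initLaw (d m L : ℕ) : Measure (Params d m L) :=
  (Measure.pi fun _ : ParamIndex d m L => gaussianReal 0 1).map (WithLp.toLp 2)

/-- `K` is the NTK matrix at initialization of the infinitely wide ReLU network with `L` hidden
layers: as all hidden widths `m` tend to infinity together, every entry of the NTK matrix at
random initialization converges in probability to the corresponding entry of `K`. -/
def IsInfiniteWidthNTK {d n : ℕ} (L : ℕ) (x : Fin n → EuclideanSpace ℝ (Fin d))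
    (K : Matrix (Fin n) (Fin n) ℝ) : Prop :=
  ∀ i j : Fin n, ∀ ε : ℝ, 0 < ε →
    Tendsto (fun m : ℕ => initLaw d m L {w | ε ≤ |ntkMatrix w x i j - K i j|}) atTop (𝓝 0)

/-- The feature matrix, whose rows are the inputs. -/
def featureMatrix {d n : ℕ} (x : Fin n → EuclideanSpace ℝ (Fin d)) :
    Matrix (Fin n) (Fin d) ℝ :=
  Matrix.of fun i k => x i k

/-- The Gram matrix of the inputs. -/
def gramMatrix {d n : ℕ} (x : Fin n → EuclideanSpace ℝ (Fin d)) : Matrix (Fin n) (Fin n) ℝ :=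
  featureMatrix x * (featureMatrix x).transpose

/-- The condition number of a positive definite matrix: the ratio of its largest to its smallest
eigenvalue (the spectrum of a matrix is its finite set of eigenvalues). -/
def conditionNumber {n : ℕ} (A : Matrix (Fin n) (Fin n) ℝ) : ℝ :=
  sSup (spectrum ℝ A) / sInf (spectrum ℝ A)

end DeepReLU

end

noncomputable section

namespace DeepReLU

open MeasureTheory ProbabilityTheory Filter Topology
open scoped NNReal ENNReal Matrix Real

/-!
Fix two inputs. Given the embeddings of one layer, the next weight matrix has independent standard
Gaussian rows, so by Chebyshev's inequality the inner products of the next embeddings, and the trace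
of the matrix of inner products of their parameter gradients, concentrate around functions of the
same quantities in the previous layer. The fluctuations are controlled by the widths and by the
Frobenius norm of the gradient matrix, which tends to zero. By induction on the layer the quantities
converge in probability, and the limits obey a recursion through the two arc-cosine kernels.

For inputs of norms `p`, `q` at an angle `θ` the limiting kernel with `L` hidden layers has
diagonal entries `(L + 1) p²`, `(L + 1) q²` and off-diagonal entry `(L + 1) p q ρ_L`, where
`ρ_0 = cos θ`; in particular `L = 0` gives the Gram matrix. The condition number of such a matrix
increases with `ρ_L`, so it is enough that `ρ_L` decreases in `L` as long as `L θ ≤ 1 / 4`. Put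
`k_L = (L + 1) ρ_L`. The recursion reads `k_{L+1} = c + t k_L`, where `c ≤ 1` is the limiting cosine
of the angle between the embeddings and `t ≤ 1 - 3 θ / (4 π)`, because the limiting angle has shrunk
to no less than `3 θ / 4`. Since `k_L ≥ (L + 1) - (L + 1)² θ / (2 π)`, this gives
`c < ρ_L + (1 - t) k_L`, which says that `ρ_{L+1} < ρ_L`.
-/

/-! ### Standard Gaussian vectors and matrices -/

/-- The real functions having finite absolute moments of every order. They form an algebra, so
that every integrability question about polynomials in Gaussian variables is answered by closure
properties. -/
def HasAllMoments {Ω : Type*} [MeasurableSpace Ω] (f : Ω → ℝ) (μ : Measure Ω) : Prop :=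
  ∀ p : ℝ≥0∞, p ≠ ∞ → MemLp f p μ

namespace HasAllMoments

variable {Ω : Type*} [MeasurableSpace Ω] {μ : Measure Ω} {f g : Ω → ℝ}

lemma mul (hf : HasAllMoments f μ) (hg : HasAllMoments g μ) :
    HasAllMoments (fun x => f x * g x) μ := by
  intro p hp
  have h2p : 2 * p ≠ ∞ := ENNReal.mul_ne_top (by simp) hp
  have : ENNReal.HolderTriple (2 * p) (2 * p) p := ⟨by
    rw [ENNReal.mul_inv (by simp) (by simp), ← add_mul, ENNReal.inv_two_add_inv_two, one_mul]⟩
  exact (hg _ h2p).mul' (hf _ h2p)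

lemma const [IsFiniteMeasure μ] (c : ℝ) : HasAllMoments (fun _ : Ω => c) μ :=
  fun _ _ => memLp_const c

lemma add (hf : HasAllMoments f μ) (hg : HasAllMoments g μ) :
    HasAllMoments (fun x => f x + g x) μ :=
  fun p hp => (hf p hp).add (hg p hp)

lemma const_mul (hf : HasAllMoments f μ) (c : ℝ) : HasAllMoments (fun x => c * f x) μ :=
  fun p hp => (hf p hp).const_mul c

lemma pow [IsFiniteMeasure μ] (hf : HasAllMoments f μ) (n : ℕ) :
    HasAllMoments (fun x => f x ^ n) μ := by
  induction n with
  | zero => simpa only [pow_zero] using const 1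
  | succ n ih => simpa only [pow_succ] using ih.mul hf

lemma sum {ι : Type*} {s : Finset ι} {F : ι → Ω → ℝ} (h : ∀ i ∈ s, HasAllMoments (F i) μ) :
    HasAllMoments (fun x => ∑ i ∈ s, F i x) μ :=
  fun p hp => memLp_finsetSum s fun i hi => h i hi p hp

lemma mono (hf : HasAllMoments f μ) (hg : AEStronglyMeasurable g μ) (h : ∀ x, |g x| ≤ |f x|) :
    HasAllMoments g μ :=
  fun p hp => (hf p hp).mono hg (ae_of_all _ h)

lemma memLp_two (hf : HasAllMoments f μ) : MemLp f 2 μ := hf 2 ENNReal.ofNat_ne_top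

lemma integrable (hf : HasAllMoments f μ) : Integrable f μ :=
  memLp_one_iff_integrable.1 (hf 1 ENNReal.one_ne_top)

lemma comp {Ω' : Type*} [MeasurableSpace Ω'] {ν : Measure Ω'} {T : Ω' → Ω}
    (hf : HasAllMoments f μ) (hT : MeasurePreserving T ν μ) :
    HasAllMoments (fun x => f (T x)) ν :=
  fun p hp => (hf p hp).comp_measurePreserving hT

end HasAllMoments

section Measurability

variable {Ω κ : Type*} [MeasurableSpace Ω] [Fintype κ]

@[fun_prop]
lemma measurable_dotProduct {f g : Ω → κ → ℝ} (hf : Measurable f) (hg : Measurable g) :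
    Measurable fun x => f x ⬝ᵥ g x := by
  unfold dotProduct
  fun_prop

end Measurability

/-- The law of a vector with i.i.d. standard normal entries. Unlike `stdGaussian` it lives on a
plain function type, where matrices act without a change of type. -/
def gaussVec (ι : Type*) [Fintype ι] : Measure (ι → ℝ) :=
  Measure.pi fun _ => gaussianReal 0 1

instance (ι : Type*) [Fintype ι] : IsProbabilityMeasure (gaussVec ι) := by
  unfold gaussVec
  infer_instance

lemma integral_sq_gaussianReal (v : ℝ≥0) : ∫ x, x ^ 2 ∂gaussianReal 0 v = v := by
  simpa only [variance_fun_id_gaussianReal, integral_id_gaussianReal, sub_zero] using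
    (variance_eq_integral (μ := gaussianReal 0 v) measurable_id'.aemeasurable).symm

lemma deriv_mul_exp_sq {p p' : ℝ → ℝ} (hp : ∀ t, HasDerivAt p (p' t) t) (v : ℝ) :
    deriv (fun t => p t * Real.exp (v * t ^ 2 / 2))
      = fun t => (p' t + v * t * p t) * Real.exp (v * t ^ 2 / 2) := by
  funext t
  have hexp : HasDerivAt (fun t : ℝ => v * t ^ 2 / 2) (v * t) t := by
    convert! (((hasDerivAt_id' t).fun_pow 2).const_mul v).div_const 2 using 1
    norm_num
    ring
  rw [((hp t).fun_mul hexp.exp).deriv]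
  ring

lemma integral_pow_four_gaussianReal (v : ℝ≥0) :
    ∫ x, x ^ 4 ∂gaussianReal 0 v = 3 * (v : ℝ) ^ 2 := by
  have hmoment : ∫ x, x ^ 4 ∂gaussianReal 0 v
      = iteratedDeriv 4 (mgf (fun x : ℝ => x) (gaussianReal 0 v)) 0 :=
    (iteratedDeriv_mgf_zero (X := fun x : ℝ => x) (by simp) 4).symm
  have hmgf : mgf (fun x : ℝ => x) (gaussianReal 0 v)
      = fun t => 1 * Real.exp (v * t ^ 2 / 2) := by
    simp only [mgf_fun_id_gaussianReal, zero_mul, zero_add, one_mul]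
  have hd1 (t : ℝ) : HasDerivAt (fun t : ℝ => 0 + v * t * 1) v t := by
    simpa using (hasDerivAt_id' t).const_mul (v : ℝ)
  have hd2 (t : ℝ) : HasDerivAt (fun t : ℝ => v + v * t * (0 + v * t * 1)) (2 * v ^ 2 * t) t := by
    convert! (((hasDerivAt_id' t).const_mul (v : ℝ)).fun_mul (hd1 t)).const_add (v : ℝ) using 1
    ring
  have hd3 (t : ℝ) : HasDerivAt
      (fun t : ℝ => 2 * v ^ 2 * t + v * t * (v + v * t * (0 + v * t * 1)))
      (3 * v ^ 2 + 3 * v ^ 3 * t ^ 2) t := by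
    convert! ((hasDerivAt_id' t).const_mul (2 * (v : ℝ) ^ 2)).fun_add
      (((hasDerivAt_id' t).const_mul (v : ℝ)).fun_mul (hd2 t)) using 1
    ring
  rw [hmoment, hmgf, iteratedDeriv_succ, iteratedDeriv_succ, iteratedDeriv_succ, iteratedDeriv_one,
    deriv_mul_exp_sq (fun t => hasDerivAt_const t 1), deriv_mul_exp_sq hd1,
    deriv_mul_exp_sq hd2, deriv_mul_exp_sq hd3]
  simp

section GaussVec

variable {ι κ : Type*} [Fintype ι] [Fintype κ]

lemma dotProduct_self_nonneg (u : ι → ℝ) : 0 ≤ u ⬝ᵥ u :=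
  Finset.sum_nonneg fun i _ => mul_self_nonneg (u i)

lemma dotProduct_sq_le (u v : ι → ℝ) : (u ⬝ᵥ v) ^ 2 ≤ (u ⬝ᵥ u) * (v ⬝ᵥ v) := by
  simpa only [dotProduct, ← sq] using Finset.sum_mul_sq_le_sq_mul_sq Finset.univ u v

lemma hasAllMoments_coord (i : ι) : HasAllMoments (fun w : ι → ℝ => w i) (gaussVec ι) :=
  HasAllMoments.comp (f := fun x => x) memLp_id_gaussianReal'
    (measurePreserving_eval (fun _ : ι => gaussianReal 0 1) i)

lemma hasAllMoments_dotProduct (u : ι → ℝ) : HasAllMoments (fun w => w ⬝ᵥ u) (gaussVec ι) :=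
  HasAllMoments.sum fun i _ => (hasAllMoments_coord i).mul (HasAllMoments.const _)

lemma integral_cexp_dotProduct (u : ι → ℝ) :
    ∫ w, Complex.exp ((w ⬝ᵥ u : ℝ) * Complex.I) ∂gaussVec ι
      = Complex.exp (-(u ⬝ᵥ u : ℝ) / 2) := by
  have h := charFun_stdGaussian (E := EuclideanSpace ℝ ι) (WithLp.toLp 2 u)
  have hnorm : ‖WithLp.toLp 2 u‖ ^ 2 = u ⬝ᵥ u := by
    rw [EuclideanSpace.real_norm_sq_eq]
    simp only [dotProduct, sq]
  rw [← map_pi_eq_stdGaussian, charFun_apply, integral_map (by fun_prop) (by fun_prop),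
    ← Complex.ofReal_pow, hnorm] at h
  simpa [gaussVec, EuclideanSpace.inner_eq_star_dotProduct, dotProduct_comm u] using h

lemma gaussVec_map_dotProduct (u : ι → ℝ) :
    (gaussVec ι).map (fun w => w ⬝ᵥ u) = gaussianReal 0 (u ⬝ᵥ u).toNNReal := by
  have : IsProbabilityMeasure ((gaussVec ι).map fun w => w ⬝ᵥ u) :=
    Measure.isProbabilityMeasure_map (by fun_prop)
  refine Measure.ext_of_charFun (funext fun t => ?_)
  rw [charFun_apply_real, integral_map (by fun_prop) (by fun_prop), charFun_gaussianReal,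
    Real.coe_toNNReal _ (dotProduct_self_nonneg u)]
  convert integral_cexp_dotProduct (t • u) using 2
  · simp [dotProduct_smul]
  · simp only [smul_dotProduct, dotProduct_smul, smul_eq_mul]
    push_cast
    ring

lemma charFunDual_gaussVec_map_pair (a b : ι → ℝ) (T : StrongDual ℝ (ℝ × ℝ)) :
    charFunDual ((gaussVec ι).map fun w => (w ⬝ᵥ a, w ⬝ᵥ b)) T
      = Complex.exp (-((T (1, 0) ^ 2 * (a ⬝ᵥ a) + 2 * T (1, 0) * T (0, 1) * (a ⬝ᵥ b)
          + T (0, 1) ^ 2 * (b ⬝ᵥ b) : ℝ) : ℂ) / 2) := by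
  have hT (w : ι → ℝ) : T (w ⬝ᵥ a, w ⬝ᵥ b) = w ⬝ᵥ (T (1, 0) • a + T (0, 1) • b) := by
    have hpair : (w ⬝ᵥ a, w ⬝ᵥ b) = (w ⬝ᵥ a) • ((1 : ℝ), (0 : ℝ)) + (w ⬝ᵥ b) • (0, 1) := by simp
    simp only [hpair, map_add, map_smul, dotProduct_add, dotProduct_smul, smul_eq_mul, mul_comm]
  rw [charFunDual_apply, integral_map (by fun_prop) (by fun_prop)]
  simp_rw [hT]
  rw [integral_cexp_dotProduct]
  congr 4
  simp only [dotProduct_add, add_dotProduct, smul_dotProduct, dotProduct_smul, smul_eq_mul,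
    dotProduct_comm b a]
  ring

/-- A pair of linear functionals of a standard Gaussian vector is Gaussian, so that its law is
determined by its covariances. -/
lemma gaussVec_map_pair_eq {u v : ι → ℝ} {u' v' : κ → ℝ} (huu : u ⬝ᵥ u = u' ⬝ᵥ u')
    (huv : u ⬝ᵥ v = u' ⬝ᵥ v') (hvv : v ⬝ᵥ v = v' ⬝ᵥ v') :
    (gaussVec ι).map (fun w => (w ⬝ᵥ u, w ⬝ᵥ v))
      = (gaussVec κ).map (fun w => (w ⬝ᵥ u', w ⬝ᵥ v')) := by
  have : IsProbabilityMeasure ((gaussVec ι).map fun w => (w ⬝ᵥ u, w ⬝ᵥ v)) :=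
    Measure.isProbabilityMeasure_map (by fun_prop)
  have : IsProbabilityMeasure ((gaussVec κ).map fun w => (w ⬝ᵥ u', w ⬝ᵥ v')) :=
    Measure.isProbabilityMeasure_map (by fun_prop)
  refine Measure.ext_of_charFunDual (funext fun T => ?_)
  rw [charFunDual_gaussVec_map_pair, charFunDual_gaussVec_map_pair, huu, huv, hvv]

lemma integral_dotProduct_sq (u : ι → ℝ) : ∫ w, (w ⬝ᵥ u) ^ 2 ∂gaussVec ι = u ⬝ᵥ u := by
  rw [← integral_map (f := fun x : ℝ => x ^ 2) (by fun_prop) (by fun_prop),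
    gaussVec_map_dotProduct, integral_sq_gaussianReal,
    Real.coe_toNNReal _ (dotProduct_self_nonneg u)]

lemma integral_dotProduct_pow_four (u : ι → ℝ) :
    ∫ w, (w ⬝ᵥ u) ^ 4 ∂gaussVec ι = 3 * (u ⬝ᵥ u) ^ 2 := by
  rw [← integral_map (f := fun x : ℝ => x ^ 4) (by fun_prop) (by fun_prop),
    gaussVec_map_dotProduct, integral_pow_four_gaussianReal,
    Real.coe_toNNReal _ (dotProduct_self_nonneg u)]

lemma integral_dotProduct_mul_dotProduct (u v : ι → ℝ) :
    ∫ w, (w ⬝ᵥ u) * (w ⬝ᵥ v) ∂gaussVec ι = u ⬝ᵥ v := by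
  have hpolar (w : ι → ℝ) : (w ⬝ᵥ u) * (w ⬝ᵥ v)
      = 1 / 4 * ((w ⬝ᵥ (u + v)) ^ 2 - (w ⬝ᵥ (u - v)) ^ 2) := by
    rw [dotProduct_add, dotProduct_sub]
    ring
  simp_rw [hpolar]
  rw [integral_const_mul, integral_sub ((hasAllMoments_dotProduct _).pow 2).integrable
    ((hasAllMoments_dotProduct _).pow 2).integrable, integral_dotProduct_sq, integral_dotProduct_sq]
  simp only [dotProduct_add, add_dotProduct, dotProduct_sub, sub_dotProduct, dotProduct_comm v u]
  ring

/-- Isserlis' formula, by polarization of the fourth moment. -/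
lemma integral_dotProduct_four (a b c d : ι → ℝ) :
    ∫ w, (w ⬝ᵥ a) * (w ⬝ᵥ b) * ((w ⬝ᵥ c) * (w ⬝ᵥ d)) ∂gaussVec ι
      = (a ⬝ᵥ b) * (c ⬝ᵥ d) + (a ⬝ᵥ c) * (b ⬝ᵥ d) + (a ⬝ᵥ d) * (b ⬝ᵥ c) := by
  have hint (u : ι → ℝ) : Integrable (fun w => (w ⬝ᵥ u) ^ 4) (gaussVec ι) :=
    ((hasAllMoments_dotProduct u).pow 4).integrable
  have hpolar (w : ι → ℝ) : (w ⬝ᵥ a) * (w ⬝ᵥ b) * ((w ⬝ᵥ c) * (w ⬝ᵥ d))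
      = (1 / 192) * (((((w ⬝ᵥ (a + b + c + d)) ^ 4 - (w ⬝ᵥ (a + b + c - d)) ^ 4)
        + ((w ⬝ᵥ (a + b - c - d)) ^ 4 - (w ⬝ᵥ (a + b - c + d)) ^ 4))
        + ((w ⬝ᵥ (a - b + c - d)) ^ 4 - (w ⬝ᵥ (a - b + c + d)) ^ 4))
        + ((w ⬝ᵥ (a - b - c + d)) ^ 4 - (w ⬝ᵥ (a - b - c - d)) ^ 4)) := by
    simp only [dotProduct_add, dotProduct_sub]
    ring
  simp_rw [hpolar]
  rw [integral_const_mul, integral_add, integral_add, integral_add, integral_sub, integral_sub,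
    integral_sub, integral_sub]
  any_goals (repeat' first | exact hint _ | apply Integrable.sub | apply Integrable.add)
  simp only [integral_dotProduct_pow_four]
  simp only [dotProduct_add, add_dotProduct, dotProduct_sub, sub_dotProduct,
    dotProduct_comm b a, dotProduct_comm c a, dotProduct_comm d a,
    dotProduct_comm c b, dotProduct_comm d b, dotProduct_comm d c]
  ring

lemma integral_dotProduct_sq_mul_sq_le (u v : ι → ℝ) :
    ∫ w, (w ⬝ᵥ u) ^ 2 * (w ⬝ᵥ v) ^ 2 ∂gaussVec ι ≤ 3 * ((u ⬝ᵥ u) * (v ⬝ᵥ v)) := by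
  have h := integral_dotProduct_four u u v v
  simp only [← sq] at h
  linarith [dotProduct_sq_le u v]

end GaussVec

/-- The squared Frobenius norm of a matrix. -/
def frobSq {ι κ : Type*} [Fintype ι] [Fintype κ] (A : Matrix ι κ ℝ) : ℝ := ∑ i, ∑ j, A i j ^ 2

section QuadraticForm

variable {ι κ : Type*} [Fintype ι] [Fintype κ]

lemma frobSq_nonneg (A : Matrix ι κ ℝ) : 0 ≤ frobSq A :=
  Finset.sum_nonneg fun _ _ => Finset.sum_nonneg fun _ _ => sq_nonneg _

lemma trace_mul_self_le_frobSq (A : Matrix ι ι ℝ) : (A * A).trace ≤ frobSq A :=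
  calc (A * A).trace
      ≤ ∑ i, ∑ j, (A i j ^ 2 + A j i ^ 2) / 2 :=
        Finset.sum_le_sum fun i _ => Finset.sum_le_sum fun j _ => by
          nlinarith [sq_nonneg (A i j - A j i)]
    _ = frobSq A := by
        simp_rw [← Finset.sum_div, Finset.sum_add_distrib]
        rw [Finset.sum_comm (f := fun i j => A j i ^ 2)]
        unfold frobSq
        ring

lemma dotProduct_mulVec_eq_sum (A : Matrix ι κ ℝ) (v : ι → ℝ) (w : κ → ℝ) :
    v ⬝ᵥ A *ᵥ w = ∑ i, ∑ j, A i j * (v i * w j) := by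
  simp only [dotProduct, Matrix.mulVec, Finset.mul_sum, mul_left_comm]

lemma hasAllMoments_quadraticForm (A : Matrix ι ι ℝ) :
    HasAllMoments (fun w => w ⬝ᵥ A *ᵥ w) (gaussVec ι) := by
  simp_rw [dotProduct_mulVec_eq_sum]
  exact HasAllMoments.sum fun i _ => HasAllMoments.sum fun j _ =>
    ((hasAllMoments_coord i).mul (hasAllMoments_coord j)).const_mul _

lemma integral_coord_mul [DecidableEq ι] (i j : ι) :
    ∫ w : ι → ℝ, w i * w j ∂gaussVec ι = if i = j then 1 else 0 := by
  simpa [Pi.single_apply, eq_comm] using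
    integral_dotProduct_mul_dotProduct (Pi.single i (1 : ℝ)) (Pi.single j 1)

lemma integral_coord_four [DecidableEq ι] (i j k l : ι) :
    ∫ w : ι → ℝ, w i * w j * (w k * w l) ∂gaussVec ι
      = (if i = j then 1 else 0) * (if k = l then 1 else 0)
        + (if i = k then 1 else 0) * (if j = l then 1 else 0)
        + (if i = l then 1 else 0) * (if j = k then 1 else 0) := by
  have h := integral_dotProduct_four (Pi.single i (1 : ℝ)) (Pi.single j 1) (Pi.single k 1)
    (Pi.single l 1)
  simp only [dotProduct_single, mul_one, Pi.single_apply] at h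
  simp only [h, eq_comm (a := j) (b := i), eq_comm (a := l) (b := k), eq_comm (a := k) (b := i),
    eq_comm (a := l) (b := j), eq_comm (a := l) (b := i), eq_comm (a := k) (b := j)]

lemma integral_quadraticForm (A : Matrix ι ι ℝ) : ∫ w, w ⬝ᵥ A *ᵥ w ∂gaussVec ι = A.trace := by
  classical
  have hint (i j : ι) : Integrable (fun w : ι → ℝ => A i j * (w i * w j)) (gaussVec ι) :=
    (((hasAllMoments_coord i).mul (hasAllMoments_coord j)).const_mul _).integrable
  simp_rw [dotProduct_mulVec_eq_sum]
  rw [integral_finsetSum _ fun i _ => integrable_finsetSum _ fun j _ => hint i j]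
  simp_rw [integral_finsetSum _ fun j _ => hint _ j, integral_const_mul, integral_coord_mul]
  simp [Matrix.trace]

lemma integral_quadraticForm_sq (A : Matrix ι ι ℝ) :
    ∫ w, (w ⬝ᵥ A *ᵥ w) ^ 2 ∂gaussVec ι = A.trace ^ 2 + frobSq A + (A * A).trace := by
  classical
  have hexpand (w : ι → ℝ) : (w ⬝ᵥ A *ᵥ w) ^ 2
      = ∑ i, ∑ j, ∑ k, ∑ l, A i j * A k l * (w i * w j * (w k * w l)) := by
    rw [dotProduct_mulVec_eq_sum, sq]
    simp only [Finset.sum_mul]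
    simp only [Finset.mul_sum]
    simp only [mul_mul_mul_comm]
  have hint (i j k l : ι) : Integrable
      (fun w : ι → ℝ => A i j * A k l * (w i * w j * (w k * w l))) (gaussVec ι) :=
    ((((hasAllMoments_coord i).mul (hasAllMoments_coord j)).mul
      ((hasAllMoments_coord k).mul (hasAllMoments_coord l))).const_mul _).integrable
  simp_rw [hexpand]
  rw [integral_finsetSum _ fun i _ => integrable_finsetSum _ fun j _ =>
    integrable_finsetSum _ fun k _ => integrable_finsetSum _ fun l _ => hint i j k l]
  simp_rw [integral_finsetSum _ fun j _ => integrable_finsetSum _ fun k _ =>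
    integrable_finsetSum _ fun l _ => hint _ j k l,
    integral_finsetSum _ fun k _ => integrable_finsetSum _ fun l _ => hint _ _ k l,
    integral_finsetSum _ fun l _ => hint _ _ _ l, integral_const_mul, integral_coord_four, mul_add,
    Finset.sum_add_distrib]
  congr 2
  · simp [Matrix.trace, sq, Finset.mul_sum, mul_comm]
  · simp [frobSq, sq]
  · simp [Matrix.mul_apply]

lemma variance_quadraticForm_le (A : Matrix ι ι ℝ) :
    Var[fun w => w ⬝ᵥ A *ᵥ w; gaussVec ι] ≤ 2 * frobSq A := by
  rw [variance_eq_sub (hasAllMoments_quadraticForm A).memLp_two]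
  simp only [Pi.pow_apply, integral_quadraticForm_sq, integral_quadraticForm]
  linarith [trace_mul_self_le_frobSq A]

lemma integral_bilinearForm_sq (A : Matrix ι κ ℝ) :
    ∫ p, (p.1 ⬝ᵥ A *ᵥ p.2) ^ 2 ∂(gaussVec ι).prod (gaussVec κ) = frobSq A := by
  have hmoments : HasAllMoments (fun p : (ι → ℝ) × (κ → ℝ) => p.1 ⬝ᵥ A *ᵥ p.2)
      ((gaussVec ι).prod (gaussVec κ)) := by
    simp_rw [dotProduct_mulVec_eq_sum]
    exact HasAllMoments.sum fun i _ => HasAllMoments.sum fun j _ =>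
      (((hasAllMoments_coord i).comp measurePreserving_fst).mul
        ((hasAllMoments_coord j).comp measurePreserving_snd)).const_mul _
  rw [integral_prod_symm _ (hmoments.pow 2).integrable]
  have hrow (i : ι) : ∫ w, (A *ᵥ w) i ^ 2 ∂gaussVec κ = A i ⬝ᵥ A i := by
    simpa only [Matrix.mulVec, dotProduct_comm (A i)] using integral_dotProduct_sq (A i)
  have hint (i : ι) : Integrable (fun w => (A *ᵥ w) i ^ 2) (gaussVec κ) := by
    simpa only [Matrix.mulVec, dotProduct_comm (A i)] using
      ((hasAllMoments_dotProduct (A i)).pow 2).integrable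
  simp_rw [integral_dotProduct_sq, dotProduct, ← sq]
  rw [integral_finsetSum _ fun i _ => hint i]
  simp only [hrow]
  simp only [frobSq, dotProduct, sq]

end QuadraticForm

section PiAverage

variable {Ω : Type*} [MeasurableSpace Ω] {μ : Measure Ω} [IsProbabilityMeasure μ] {φ : Ω → ℝ}
  {m : ℕ}

lemma memLp_average_pi (hφ : MemLp φ 2 μ) :
    MemLp (fun W : Fin m → Ω => (∑ i, φ (W i)) / m) 2 (Measure.pi fun _ => μ) := by
  simp_rw [div_eq_inv_mul]
  exact (memLp_finsetSum _ fun i _ =>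
    hφ.comp_measurePreserving (measurePreserving_eval (fun _ => μ) i)).const_mul _

lemma integral_average_pi (hφ : Integrable φ μ) (hm : 0 < m) :
    ∫ W : Fin m → Ω, (∑ i, φ (W i)) / m ∂(Measure.pi fun _ => μ) = ∫ x, φ x ∂μ := by
  rw [integral_div, integral_finsetSum _ fun i _ => integrable_comp_eval (μ := fun _ => μ) hφ]
  simp only [integral_comp_eval (μ := fun _ : Fin m => μ) hφ.aestronglyMeasurable,
    Finset.sum_const, Finset.card_univ, Fintype.card_fin, nsmul_eq_mul]
  field_simp

lemma variance_average_pi (hφ : MemLp φ 2 μ) (hm : 0 < m) :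
    Var[fun W : Fin m → Ω => (∑ i, φ (W i)) / m; Measure.pi fun _ => μ] = Var[φ; μ] / m := by
  have hsum := variance_sum_pi (μ := fun _ : Fin m => μ) fun _ => hφ
  simp only [Finset.sum_const, Finset.card_univ, Fintype.card_fin, nsmul_eq_mul] at hsum
  have hfun : (fun W : Fin m → Ω => (∑ i, φ (W i)) / m)
      = fun W => (m : ℝ)⁻¹ * (∑ i, fun W : Fin m → Ω => φ (W i)) W := by
    funext W
    rw [Finset.sum_apply, div_eq_inv_mul]
  rw [hfun, variance_const_mul, hsum]
  field_simp

lemma measure_average_pi_sub_integral_ge_le (hφ : MemLp φ 2 μ) (hm : 0 < m) {ε : ℝ} (hε : 0 < ε) :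
    Measure.pi (fun _ : Fin m => μ) {W | ε ≤ |(∑ i, φ (W i)) / m - ∫ x, φ x ∂μ|}
      ≤ ENNReal.ofReal ((∫ x, φ x ^ 2 ∂μ) / (m * ε ^ 2)) := by
  have hcheb := meas_ge_le_variance_div_sq (memLp_average_pi (m := m) hφ) hε
  rw [integral_average_pi (hφ.integrable one_le_two) hm, variance_average_pi hφ hm, div_div]
    at hcheb
  refine hcheb.trans (ENNReal.ofReal_le_ofReal ?_)
  gcongr
  exact variance_le_expectation_sq hφ.aestronglyMeasurable

end PiAverage

/-- The law of a matrix with `m` rows and i.i.d. standard normal entries, given by its rows. -/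
def gaussMat (m : ℕ) (κ : Type*) [Fintype κ] : Measure (Fin m → κ → ℝ) :=
  Measure.pi fun _ => gaussVec κ

section GaussMat

variable {m : ℕ} {κ : Type*} [Fintype κ]

instance : IsProbabilityMeasure (gaussMat m κ) := by
  unfold gaussMat
  infer_instance

lemma measurePreserving_row (i : Fin m) :
    MeasurePreserving (fun W : Fin m → κ → ℝ => W i) (gaussMat m κ) (gaussVec κ) :=
  measurePreserving_eval (fun _ : Fin m => gaussVec κ) i

lemma measurePreserving_row_pair {i j : Fin m} (hij : i ≠ j) :
    MeasurePreserving (fun W : Fin m → κ → ℝ => (W i, W j)) (gaussMat m κ)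
      ((gaussVec κ).prod (gaussVec κ)) := by
  refine ⟨by fun_prop, ?_⟩
  have hindep : IndepFun (fun W : Fin m → κ → ℝ => W i) (fun W => W j) (gaussMat m κ) :=
    (iIndepFun_pi (μ := fun _ : Fin m => gaussVec κ) (X := fun _ w => w)
      fun _ => by fun_prop).indepFun hij
  rw [(indepFun_iff_map_prod_eq_prod_map_map (measurePreserving_row i).aemeasurable
      (measurePreserving_row j).aemeasurable).1 hindep,
    (measurePreserving_row i).map_eq, (measurePreserving_row j).map_eq]

lemma integral_bilinearForm_rows_sq_le (A : Matrix κ κ ℝ) (i j : Fin m) :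
    ∫ W, (W i ⬝ᵥ A *ᵥ W j) ^ 2 ∂gaussMat m κ
      ≤ frobSq A + if i = j then A.trace ^ 2 + frobSq A else 0 := by
  split_ifs with hij
  · subst hij
    have h := integral_quadraticForm_sq A
    rw [← (measurePreserving_row i).map_eq,
      integral_map (measurePreserving_row i).aemeasurable (by fun_prop)] at h
    rw [h]
    linarith [trace_mul_self_le_frobSq A]
  · have h := integral_bilinearForm_sq A
    rw [← (measurePreserving_row_pair hij).map_eq,
      integral_map (measurePreserving_row_pair hij).aemeasurable (by fun_prop)] at h
    rw [h, add_zero]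

end GaussMat

/-! ### Arc-cosine kernels -/

/-- The derivative of the ReLU, with value `0` at `0`. -/
def heaviside (z : ℝ) : ℝ := if 0 < z then 1 else 0

/-- The arc-cosine kernel of degree `0`, as a function of the cosine of the angle. -/
def arcCos0 (ρ : ℝ) : ℝ := 1 - Real.arccos ρ / π

/-- The arc-cosine kernel of degree `1`, as a function of the cosine of the angle. -/
def arcCos1 (ρ : ℝ) : ℝ := (Real.sin (Real.arccos ρ) + (π - Real.arccos ρ) * ρ) / π

lemma heaviside_of_pos {z : ℝ} (hz : 0 < z) : heaviside z = 1 := if_pos hz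

lemma heaviside_of_nonpos {z : ℝ} (hz : z ≤ 0) : heaviside z = 0 := if_neg hz.not_gt

lemma heaviside_nonneg (z : ℝ) : 0 ≤ heaviside z := by
  unfold heaviside
  split_ifs <;> norm_num

lemma heaviside_le_one (z : ℝ) : heaviside z ≤ 1 := by
  unfold heaviside
  split_ifs <;> norm_num

lemma heaviside_mul_of_pos {a : ℝ} (ha : 0 < a) (z : ℝ) : heaviside (a * z) = heaviside z := by
  simp [heaviside, ha]

lemma relu_mul_of_nonneg {a : ℝ} (ha : 0 ≤ a) (z : ℝ) : relu (a * z) = a * relu z := by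
  simp [relu, mul_max_of_nonneg _ _ ha]

lemma relu_eq_heaviside_mul (z : ℝ) : relu z = heaviside z * z := by
  rcases lt_or_ge 0 z with hz | hz
  · rw [heaviside_of_pos hz, one_mul, relu, max_eq_right hz.le]
  · rw [heaviside_of_nonpos hz, zero_mul, relu, max_eq_left hz]

lemma abs_relu_le (z : ℝ) : |relu z| ≤ |z| := by
  rw [relu, abs_of_nonneg (le_max_left _ _)]
  exact max_le (abs_nonneg _) (le_abs_self _)

@[fun_prop]
lemma measurable_heaviside : Measurable heaviside :=
  Measurable.ite measurableSet_Ioi measurable_const measurable_const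

@[fun_prop]
lemma measurable_relu : Measurable relu := measurable_const.max measurable_id

lemma continuous_arcCos0 : Continuous arcCos0 := by
  unfold arcCos0
  fun_prop

lemma continuous_arcCos1 : Continuous arcCos1 := by
  unfold arcCos1
  fun_prop

lemma arcCos0_nonneg (ρ : ℝ) : 0 ≤ arcCos0 ρ :=
  sub_nonneg.2 (div_le_one_of_le₀ (Real.arccos_le_pi _) Real.pi_pos.le)

lemma arcCos0_le_one (ρ : ℝ) : arcCos0 ρ ≤ 1 :=
  sub_le_self 1 (div_nonneg (Real.arccos_nonneg ρ) Real.pi_pos.le)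

lemma arcCos0_one : arcCos0 1 = 1 := by simp [arcCos0]

lemma arcCos1_one : arcCos1 1 = 1 := by simp [arcCos1, Real.pi_ne_zero]

section Plane

lemma gaussianPDFReal_mul_gaussianPDFReal (x y : ℝ) :
    gaussianPDFReal 0 1 x * gaussianPDFReal 0 1 y
      = (2 * π)⁻¹ * Real.exp (-(x ^ 2 + y ^ 2) / 2) := by
  simp only [gaussianPDFReal, NNReal.coe_one, mul_one, sub_zero]
  rw [mul_mul_mul_comm, ← Real.exp_add, ← mul_inv, Real.mul_self_sqrt (by positivity)]
  congr 2
  ring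

lemma integral_gaussian_plane (G : ℝ × ℝ → ℝ) :
    ∫ p, G p ∂(gaussianReal 0 1).prod (gaussianReal 0 1)
      = ∫ p : ℝ × ℝ, (2 * π)⁻¹ * Real.exp (-(p.1 ^ 2 + p.2 ^ 2) / 2) * G p := by
  rw [gaussianReal_of_var_ne_zero 0 one_ne_zero, prod_withDensity (by fun_prop) (by fun_prop),
    integral_withDensity_eq_integral_toReal_smul (by fun_prop)
      (ae_of_all _ fun p => ENNReal.mul_lt_top gaussianPDF_lt_top gaussianPDF_lt_top)]
  simp only [ENNReal.toReal_mul, toReal_gaussianPDF, gaussianPDFReal_mul_gaussianPDFReal,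
    smul_eq_mul]
  rfl

lemma integral_pow_mul_exp_neg_sq_div_two (k : ℕ) :
    ∫ r in Set.Ioi (0 : ℝ), r ^ (k + 1) * Real.exp (-r ^ 2 / 2)
      = 2 ^ ((k : ℝ) / 2) * Real.Gamma ((k : ℝ) / 2 + 1) := by
  have h := integral_rpow_mul_exp_neg_mul_rpow (p := 2) (q := (k : ℝ) + 1) (b := 1 / 2)
    two_pos (by linarith [k.cast_nonneg (α := ℝ)]) one_half_pos
  have hpow (r : ℝ) : r ^ ((k : ℝ) + 1) = r ^ (k + 1) := by exact_mod_cast Real.rpow_natCast r _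
  have hconst : (1 / 2 : ℝ) ^ (-((k : ℝ) + 1 + 1) / 2) * (1 / 2) = 2 ^ ((k : ℝ) / 2) := by
    rw [one_div, Real.inv_rpow zero_le_two, ← Real.rpow_neg zero_le_two,
      ← Real.rpow_neg_one 2, ← Real.rpow_add two_pos]
    congr 1
    ring
  simp only [hpow, Real.rpow_two] at h
  rw [hconst, add_assoc, one_add_one_eq_two, add_div, div_self two_ne_zero] at h
  rw [← h]
  refine setIntegral_congr_fun measurableSet_Ioi fun r _ => ?_
  congr 2
  ring

/-- In polar coordinates the radial and the angular variables separate. -/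
lemma integral_gaussian_plane_of_homogeneous (k : ℕ) (G : ℝ × ℝ → ℝ)
    (hG : ∀ r : ℝ, 0 < r → ∀ x y, G (r * x, r * y) = r ^ k * G (x, y)) :
    ∫ p, G p ∂(gaussianReal 0 1).prod (gaussianReal 0 1)
      = (2 * π)⁻¹ * (2 ^ ((k : ℝ) / 2) * Real.Gamma ((k : ℝ) / 2 + 1))
        * ∫ t in Set.Ioo (-π) π, G (Real.cos t, Real.sin t) := by
  rw [← integral_pow_mul_exp_neg_sq_div_two, integral_gaussian_plane,
    ← integral_comp_polarCoord_symm, mul_assoc, ← setIntegral_prod_mul, ← integral_const_mul]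
  refine setIntegral_congr_fun polarCoord.open_target.measurableSet fun p hp => ?_
  have hnorm : (p.1 * Real.cos p.2) ^ 2 + (p.1 * Real.sin p.2) ^ 2 = p.1 ^ 2 := by
    rw [mul_pow, mul_pow, ← mul_add, Real.cos_sq_add_sin_sq, mul_one]
  simp only [polarCoord_symm_apply, smul_eq_mul, hG p.1 hp.1, hnorm]
  ring

lemma heaviside_cos_mul_heaviside_cos_sub {θ t : ℝ} (hθ₀ : 0 ≤ θ) (hθπ : θ ≤ π)
    (ht : t ∈ Set.Ioo (-π) π) :
    heaviside (Real.cos t) * heaviside (Real.cos (t - θ))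
      = Set.indicator (Set.Ioo (θ - π / 2) (π / 2)) 1 t := by
  obtain ⟨htl, htr⟩ := ht
  by_cases hmem : t ∈ Set.Ioo (θ - π / 2) (π / 2)
  · have hcos : 0 < Real.cos t := Real.cos_pos_of_mem_Ioo ⟨by linarith [hmem.1], hmem.2⟩
    have hcos_sub : 0 < Real.cos (t - θ) :=
      Real.cos_pos_of_mem_Ioo ⟨by linarith [hmem.1], by linarith [hmem.2]⟩
    rw [Set.indicator_of_mem hmem, heaviside_of_pos hcos, heaviside_of_pos hcos_sub, mul_one,
      Pi.one_apply]
  rw [Set.indicator_of_notMem hmem, mul_eq_zero]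
  rcases le_or_gt (π / 2) t with hr | hr
  · exact .inl (heaviside_of_nonpos
      (Real.cos_nonpos_of_pi_div_two_le_of_le hr (by linarith)))
  rcases le_or_gt t (-(π / 2)) with hl | hl
  · rw [← Real.cos_neg t]
    exact .inl (heaviside_of_nonpos
      (Real.cos_nonpos_of_pi_div_two_le_of_le (by linarith) (by linarith)))
  · have hθt : t ≤ θ - π / 2 := not_lt.1 fun h => hmem ⟨h, hr⟩
    rw [← Real.cos_neg (t - θ)]
    exact .inr (heaviside_of_nonpos
      (Real.cos_nonpos_of_pi_div_two_le_of_le (by linarith) (by linarith)))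

lemma integral_heaviside_cos_mul_heaviside_cos_sub {θ : ℝ} (hθ₀ : 0 ≤ θ) (hθπ : θ ≤ π)
    (g : ℝ → ℝ) :
    ∫ t in Set.Ioo (-π) π, heaviside (Real.cos t) * heaviside (Real.cos (t - θ)) * g t
      = ∫ t in (θ - π / 2)..(π / 2), g t := by
  have hindicator : Set.EqOn
      (fun t => heaviside (Real.cos t) * heaviside (Real.cos (t - θ)) * g t)
      (Set.indicator (Set.Ioo (θ - π / 2) (π / 2)) g) (Set.Ioo (-π) π) := fun t ht => by
    simp only [heaviside_cos_mul_heaviside_cos_sub hθ₀ hθπ ht, ← Set.indicator_mul_left,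
      Pi.one_apply, one_mul]
  rw [setIntegral_congr_fun measurableSet_Ioo hindicator, setIntegral_indicator measurableSet_Ioo,
    Set.inter_eq_right.2 (Set.Ioo_subset_Ioo (by linarith) (by linarith)),
    intervalIntegral.integral_of_le (by linarith), integral_Ioc_eq_integral_Ioo]

lemma integral_cos_mul_cos_sub (θ : ℝ) :
    ∫ t in (θ - π / 2)..(π / 2), Real.cos t * Real.cos (t - θ)
      = (Real.sin θ + (π - θ) * Real.cos θ) / 2 := by
  have hprod (t : ℝ) :
      Real.cos t * Real.cos (t - θ) = (Real.cos θ + Real.cos (2 * t - θ)) / 2 := by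
    have hsum := Real.cos_add_cos θ (2 * t - θ)
    rw [show (θ + (2 * t - θ)) / 2 = t by ring, show (θ - (2 * t - θ)) / 2 = -(t - θ) by ring,
      Real.cos_neg] at hsum
    linarith
  have hsin_upper : Real.sin (2 * (π / 2) - θ) = Real.sin θ := by
    rw [mul_div_cancel₀ _ two_ne_zero, Real.sin_pi_sub]
  have hsin_lower : Real.sin (2 * (θ - π / 2) - θ) = -Real.sin θ := by
    rw [show 2 * (θ - π / 2) - θ = θ - π by ring, Real.sin_sub_pi]
  simp_rw [hprod]
  rw [intervalIntegral.integral_div, intervalIntegral.integral_add (by simp)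
      (Continuous.intervalIntegrable (by fun_prop) _ _), intervalIntegral.integral_const,
    intervalIntegral.integral_comp_mul_sub (fun t => Real.cos t) two_ne_zero, integral_cos,
    hsin_upper, hsin_lower, smul_eq_mul, smul_eq_mul]
  ring

end Plane

section Kernel

variable {ι : Type*} [Fintype ι]

lemma hasAllMoments_relu_dotProduct (u : ι → ℝ) :
    HasAllMoments (fun w => relu (w ⬝ᵥ u)) (gaussVec ι) :=
  (hasAllMoments_dotProduct u).mono (Measurable.aestronglyMeasurable (by fun_prop))
    fun _ => abs_relu_le _

lemma hasAllMoments_heaviside_dotProduct (u : ι → ℝ) :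
    HasAllMoments (fun w => heaviside (w ⬝ᵥ u)) (gaussVec ι) :=
  (HasAllMoments.const 1).mono (Measurable.aestronglyMeasurable (by fun_prop)) fun _ => by
    simpa only [abs_of_nonneg (heaviside_nonneg _), abs_one] using heaviside_le_one _

lemma integral_comp_dotProduct_pair (u v : ι → ℝ) {F : ℝ × ℝ → ℝ} (hF : Measurable F) {θ a b : ℝ}
    (hu : u ⬝ᵥ u = a ^ 2) (hv : v ⬝ᵥ v = b ^ 2) (huv : u ⬝ᵥ v = a * b * Real.cos θ) :
    ∫ w, F (w ⬝ᵥ u, w ⬝ᵥ v) ∂gaussVec ι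
      = ∫ p : ℝ × ℝ, F (a * p.1, b * (p.1 * Real.cos θ + p.2 * Real.sin θ))
        ∂(gaussianReal 0 1).prod (gaussianReal 0 1) := by
  have hlaw := gaussVec_map_pair_eq (u := u) (v := v) (u' := ![a, 0])
    (v' := ![b * Real.cos θ, b * Real.sin θ]) (by rw [hu]; simp [sq])
    (by rw [huv]; simp [mul_assoc]) (by
      simp only [hv, Matrix.vec2_dotProduct']
      linear_combination b ^ 2 * (Real.cos_sq_add_sin_sq θ).symm)
  have hplane : (gaussianReal 0 1).prod (gaussianReal 0 1)
      = (gaussVec (Fin 2)).map (MeasurableEquiv.piFinTwo fun _ => ℝ) :=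
    (measurePreserving_piFinTwo fun _ : Fin 2 => gaussianReal 0 1).map_eq.symm
  have hF' : Measurable fun p : ℝ × ℝ =>
      F (a * p.1, b * (p.1 * Real.cos θ + p.2 * Real.sin θ)) := hF.comp (by fun_prop)
  rw [← integral_map (φ := fun w : ι → ℝ => (w ⬝ᵥ u, w ⬝ᵥ v)) (by fun_prop)
      hF.aestronglyMeasurable, hlaw, integral_map (by fun_prop) hF.aestronglyMeasurable, hplane,
    integral_map (MeasurableEquiv.measurable _).aemeasurable hF'.aestronglyMeasurable]
  simp [dotProduct, mul_comm, mul_add, mul_left_comm]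

/-- The cosine of the angle between two coordinate vectors; it is `0` if one of them vanishes. -/
def cosine (u v : ι → ℝ) : ℝ := u ⬝ᵥ v / (√(u ⬝ᵥ u) * √(v ⬝ᵥ v))

lemma abs_cosine_le_one (u v : ι → ℝ) : |cosine u v| ≤ 1 := by
  rw [cosine, abs_div, abs_of_nonneg (mul_nonneg (Real.sqrt_nonneg _) (Real.sqrt_nonneg _))]
  refine div_le_one_of_le₀ ?_ (by positivity)
  rw [← Real.sqrt_mul (dotProduct_self_nonneg u)]
  exact Real.abs_le_sqrt (dotProduct_sq_le u v)

lemma cos_arccos_cosine (u v : ι → ℝ) : Real.cos (Real.arccos (cosine u v)) = cosine u v :=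
  have h := abs_le.1 (abs_cosine_le_one u v)
  Real.cos_arccos h.1 h.2

lemma dotProduct_eq_sqrt_mul_cos {u v : ι → ℝ} (hu : 0 < u ⬝ᵥ u) (hv : 0 < v ⬝ᵥ v) :
    u ⬝ᵥ v = √(u ⬝ᵥ u) * √(v ⬝ᵥ v) * Real.cos (Real.arccos (cosine u v)) := by
  have := Real.sqrt_pos.2 hu
  have := Real.sqrt_pos.2 hv
  rw [cos_arccos_cosine, cosine]
  field_simp

lemma integral_heaviside_mul_heaviside {u v : ι → ℝ} (hu : 0 < u ⬝ᵥ u) (hv : 0 < v ⬝ᵥ v) :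
    ∫ w, heaviside (w ⬝ᵥ u) * heaviside (w ⬝ᵥ v) ∂gaussVec ι = arcCos0 (cosine u v) / 2 := by
  set θ := Real.arccos (cosine u v) with hθ
  rw [integral_comp_dotProduct_pair u v (F := fun p => heaviside p.1 * heaviside p.2)
    (by fun_prop) (Real.sq_sqrt hu.le).symm (Real.sq_sqrt hv.le).symm
    (dotProduct_eq_sqrt_mul_cos hu hv)]
  simp only [heaviside_mul_of_pos (Real.sqrt_pos.2 hu), heaviside_mul_of_pos (Real.sqrt_pos.2 hv),
    ← hθ]
  rw [integral_gaussian_plane_of_homogeneous 0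
    (fun p => heaviside p.1 * heaviside (p.1 * Real.cos θ + p.2 * Real.sin θ))]
  · have hangle := integral_heaviside_cos_mul_heaviside_cos_sub
      (Real.arccos_nonneg (cosine u v)) (Real.arccos_le_pi _) fun _ => 1
    simp only [mul_one, ← hθ, Real.cos_sub, intervalIntegral.integral_const, smul_eq_mul] at hangle
    simp only [hangle, Nat.cast_zero, zero_div, Real.rpow_zero, zero_add, Real.Gamma_one, mul_one,
      arcCos0, ← hθ]
    field_simp
    ring
  · intro r hr x y
    simp only [mul_assoc, ← mul_add, heaviside_mul_of_pos hr, pow_zero, one_mul]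

lemma integral_relu_mul_relu (u v : ι → ℝ) :
    ∫ w, relu (w ⬝ᵥ u) * relu (w ⬝ᵥ v) ∂gaussVec ι
      = √(u ⬝ᵥ u) * √(v ⬝ᵥ v) * arcCos1 (cosine u v) / 2 := by
  rcases (dotProduct_self_nonneg u).eq_or_lt with hu | hu
  · simp [dotProduct_self_eq_zero.1 hu.symm, relu]
  rcases (dotProduct_self_nonneg v).eq_or_lt with hv | hv
  · simp [dotProduct_self_eq_zero.1 hv.symm, relu]
  set θ := Real.arccos (cosine u v) with hθ
  rw [integral_comp_dotProduct_pair u v (F := fun p => relu p.1 * relu p.2) (by fun_prop)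
    (Real.sq_sqrt hu.le).symm (Real.sq_sqrt hv.le).symm (dotProduct_eq_sqrt_mul_cos hu hv)]
  simp only [relu_mul_of_nonneg (Real.sqrt_nonneg _), mul_mul_mul_comm _ (relu _) _ (relu _),
    ← hθ]
  rw [integral_const_mul, integral_gaussian_plane_of_homogeneous 2
    (fun p => relu p.1 * relu (p.1 * Real.cos θ + p.2 * Real.sin θ))]
  · have hangle := integral_heaviside_cos_mul_heaviside_cos_sub
      (Real.arccos_nonneg (cosine u v)) (Real.arccos_le_pi _)
      fun t => Real.cos t * Real.cos (t - θ)
    have hrelu (t : ℝ) : relu (Real.cos t) * relu (Real.cos (t - θ))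
        = heaviside (Real.cos t) * heaviside (Real.cos (t - θ))
          * (Real.cos t * Real.cos (t - θ)) := by
      rw [relu_eq_heaviside_mul, relu_eq_heaviside_mul, mul_mul_mul_comm]
    rw [← hθ, integral_cos_mul_cos_sub] at hangle
    simp only [← Real.cos_sub, hrelu, hangle, Nat.cast_ofNat, div_self (two_ne_zero' ℝ),
      Real.rpow_one, one_add_one_eq_two, Real.Gamma_two, mul_one, arcCos1, ← hθ]
    rw [hθ, cos_arccos_cosine]
    field_simp
  · intro r hr x y
    simp only [mul_assoc, ← mul_add, relu_mul_of_nonneg hr.le]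
    ring

end Kernel

/-! ### One random layer -/

/-- The data of a hidden layer that the next layer builds on, for a fixed pair of inputs: the two
embeddings, and the matrix of inner products of the parameter gradients of their entries. -/
abbrev LayerState (κ : Type*) : Type _ := (κ → ℝ) × (κ → ℝ) × Matrix κ κ ℝ

section Step

variable {m : ℕ} {κ : Type*} [Fintype κ]

/-- The embedding in the next layer, from the embedding `a` and the weight matrix `W`. -/
def stepVec (W : Fin m → κ → ℝ) (a : κ → ℝ) : Fin m → ℝ :=
  fun i => √2 / √m * relu (W i ⬝ᵥ a)

/-- The inner products of the parameter gradients of the entries of the next embeddings, from the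
embeddings `a`, `b` and the inner products `A` of the gradients of their entries. The term with
`a ⬝ᵥ b` is the contribution of the weights `W` themselves. -/
def stepMat (W : Fin m → κ → ℝ) (a b : κ → ℝ) (A : Matrix κ κ ℝ) : Matrix (Fin m) (Fin m) ℝ :=
  Matrix.of fun i j => 2 / (m : ℝ) * (heaviside (W i ⬝ᵥ a) * heaviside (W j ⬝ᵥ b))
    * ((if i = j then a ⬝ᵥ b else 0) + W i ⬝ᵥ A *ᵥ W j)

/-- The state of the next layer, from the state of a layer and the weight matrix `W`. -/
def stepState (W : Fin m → κ → ℝ) (s : LayerState κ) : LayerState (Fin m) :=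
  (stepVec W s.1, stepVec W s.2.1, stepMat W s.1 s.2.1 s.2.2)

lemma sqrt_two_div_sqrt_mul_self (m : ℕ) : √2 / √(m : ℝ) * (√2 / √m) = 2 / m := by
  rw [div_mul_div_comm, Real.mul_self_sqrt zero_le_two, Real.mul_self_sqrt m.cast_nonneg]

lemma stepVec_dotProduct_stepVec (W : Fin m → κ → ℝ) (a b : κ → ℝ) :
    stepVec W a ⬝ᵥ stepVec W b = (∑ i, 2 * (relu (W i ⬝ᵥ a) * relu (W i ⬝ᵥ b))) / m := by
  rw [Finset.sum_div]
  refine Finset.sum_congr rfl fun i _ => ?_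
  rw [stepVec, stepVec, mul_mul_mul_comm, sqrt_two_div_sqrt_mul_self]
  ring

lemma trace_stepMat (W : Fin m → κ → ℝ) (a b : κ → ℝ) (A : Matrix κ κ ℝ) :
    (stepMat W a b A).trace
      = (∑ i, 2 * (heaviside (W i ⬝ᵥ a) * heaviside (W i ⬝ᵥ b)
          * (a ⬝ᵥ b + W i ⬝ᵥ A *ᵥ W i))) / m := by
  rw [Finset.sum_div]
  refine Finset.sum_congr rfl fun i _ => ?_
  simp only [stepMat, Matrix.diag_apply, Matrix.of_apply, if_true]
  ring

end Step

/-- The limit of the inner product of the embeddings in the next layer, where `P` and `Q` are their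
squared norms and `R` is their inner product. -/
def nextInner (P Q R : ℝ) : ℝ := √P * √Q * arcCos1 (R / (√P * √Q))

/-- The limit of the trace of the gradient matrix in the next layer, where `P` and `Q` are the
squared norms of the embeddings, `R` is their inner product and `T` is the trace. -/
def nextTrace (P Q R T : ℝ) : ℝ := arcCos0 (R / (√P * √Q)) * (R + T)

lemma nextInner_self {P : ℝ} (hP : 0 ≤ P) : nextInner P P P = P := by
  rcases hP.eq_or_lt with rfl | hP
  · simp [nextInner]
  · rw [nextInner, Real.mul_self_sqrt hP.le, div_self hP.ne', arcCos1_one, mul_one]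

section Concentration

variable {m : ℕ} {κ : Type*} [Fintype κ]

lemma integral_relu_mul_relu_sq_le (a b : κ → ℝ) :
    ∫ w, (2 * (relu (w ⬝ᵥ a) * relu (w ⬝ᵥ b))) ^ 2 ∂gaussVec κ ≤ 12 * ((a ⬝ᵥ a) * (b ⬝ᵥ b)) :=
  calc ∫ w, (2 * (relu (w ⬝ᵥ a) * relu (w ⬝ᵥ b))) ^ 2 ∂gaussVec κ
      ≤ ∫ w, 4 * ((w ⬝ᵥ a) ^ 2 * (w ⬝ᵥ b) ^ 2) ∂gaussVec κ := by
        refine integral_mono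
          ((((hasAllMoments_relu_dotProduct a).mul
            (hasAllMoments_relu_dotProduct b)).const_mul 2).pow 2).integrable
          ((((hasAllMoments_dotProduct a).pow 2).mul
            ((hasAllMoments_dotProduct b).pow 2)).const_mul 4).integrable fun w => ?_
        have ha := sq_le_sq.2 (abs_relu_le (w ⬝ᵥ a))
        have hb := sq_le_sq.2 (abs_relu_le (w ⬝ᵥ b))
        have := mul_le_mul ha hb (sq_nonneg _) (sq_nonneg _)
        dsimp only
        nlinarith
    _ ≤ 12 * ((a ⬝ᵥ a) * (b ⬝ᵥ b)) := by
        rw [integral_const_mul]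
        linarith [integral_dotProduct_sq_mul_sq_le a b]

lemma gaussMat_abs_stepVec_dotProduct_sub_ge_le (a b : κ → ℝ) (hm : 0 < m) {ε : ℝ} (hε : 0 < ε) :
    gaussMat m κ {W | ε ≤ |stepVec W a ⬝ᵥ stepVec W b - nextInner (a ⬝ᵥ a) (b ⬝ᵥ b) (a ⬝ᵥ b)|}
      ≤ ENNReal.ofReal (12 * ((a ⬝ᵥ a) * (b ⬝ᵥ b)) / (m * ε ^ 2)) := by
  have hmoments : HasAllMoments (fun w => 2 * (relu (w ⬝ᵥ a) * relu (w ⬝ᵥ b))) (gaussVec κ) :=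
    ((hasAllMoments_relu_dotProduct a).mul (hasAllMoments_relu_dotProduct b)).const_mul 2
  have hmean : ∫ w, 2 * (relu (w ⬝ᵥ a) * relu (w ⬝ᵥ b)) ∂gaussVec κ
      = nextInner (a ⬝ᵥ a) (b ⬝ᵥ b) (a ⬝ᵥ b) := by
    rw [integral_const_mul, integral_relu_mul_relu, mul_div_cancel₀ _ two_ne_zero]
    rfl
  have hcheb := measure_average_pi_sub_integral_ge_le hmoments.memLp_two hm hε
  simp_rw [← stepVec_dotProduct_stepVec, hmean] at hcheb
  refine hcheb.trans (ENNReal.ofReal_le_ofReal ?_)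
  gcongr
  exact integral_relu_mul_relu_sq_le a b

lemma integral_abs_le_sqrt_integral_sq {Ω : Type*} [MeasurableSpace Ω] {μ : Measure Ω}
    [IsProbabilityMeasure μ] {X : Ω → ℝ} (hX : MemLp X 2 μ) :
    ∫ ω, |X ω| ∂μ ≤ √(∫ ω, X ω ^ 2 ∂μ) := by
  have h := variance_nonneg (fun ω => |X ω|) μ
  rw [variance_eq_sub (by simpa only [Real.norm_eq_abs] using hX.norm)] at h
  simp only [Pi.pow_apply, sq_abs] at h
  exact Real.le_sqrt_of_sq_le (by linarith)

lemma abs_integral_mul_sub_integral_le {Ω : Type*} [MeasurableSpace Ω] {μ : Measure Ω}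
    [IsProbabilityMeasure μ] {h X : Ω → ℝ} (hh : ∀ ω, |h ω| ≤ 1) (hX : MemLp X 2 μ) :
    |∫ ω, h ω * (X ω - μ[X]) ∂μ| ≤ √(Var[X; μ]) := by
  have hX' : MemLp (fun ω => X ω - μ[X]) 2 μ := hX.sub (memLp_const _)
  rw [variance_eq_integral hX.aestronglyMeasurable.aemeasurable, ← Real.norm_eq_abs]
  refine (norm_integral_le_of_norm_le (hX'.integrable one_le_two).abs
    (ae_of_all _ fun ω => ?_)).trans (integral_abs_le_sqrt_integral_sq hX')
  rw [norm_mul, Real.norm_eq_abs, Real.norm_eq_abs]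
  exact mul_le_of_le_one_left (abs_nonneg _) (hh ω)

lemma abs_heaviside_mul_heaviside_le_one (x y : ℝ) : |heaviside x * heaviside y| ≤ 1 := by
  rw [abs_of_nonneg (mul_nonneg (heaviside_nonneg _) (heaviside_nonneg _))]
  exact mul_le_one₀ (heaviside_le_one _) (heaviside_nonneg _) (heaviside_le_one _)

lemma hasAllMoments_heaviside_mul_quadraticForm (a b : κ → ℝ) (A : Matrix κ κ ℝ) (c : ℝ) :
    HasAllMoments (fun w => 2 * (heaviside (w ⬝ᵥ a) * heaviside (w ⬝ᵥ b) * (c + w ⬝ᵥ A *ᵥ w)))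
      (gaussVec κ) :=
  (((hasAllMoments_heaviside_dotProduct a).mul (hasAllMoments_heaviside_dotProduct b)).mul
    ((HasAllMoments.const c).add (hasAllMoments_quadraticForm A))).const_mul 2

lemma abs_integral_heaviside_mul_quadraticForm_sub_le {a b : κ → ℝ} (ha : 0 < a ⬝ᵥ a)
    (hb : 0 < b ⬝ᵥ b) (A : Matrix κ κ ℝ) :
    |∫ w, 2 * (heaviside (w ⬝ᵥ a) * heaviside (w ⬝ᵥ b) * (a ⬝ᵥ b + w ⬝ᵥ A *ᵥ w)) ∂gaussVec κ
        - nextTrace (a ⬝ᵥ a) (b ⬝ᵥ b) (a ⬝ᵥ b) A.trace| ≤ 2 * √(2 * frobSq A) := by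
  set H : (κ → ℝ) → ℝ := fun w => heaviside (w ⬝ᵥ a) * heaviside (w ⬝ᵥ b)
  have hHmoments : HasAllMoments H (gaussVec κ) :=
    (hasAllMoments_heaviside_dotProduct a).mul (hasAllMoments_heaviside_dotProduct b)
  have hcentered : HasAllMoments (fun w => w ⬝ᵥ A *ᵥ w - A.trace) (gaussVec κ) := by
    simpa only [sub_eq_add_neg] using
      (hasAllMoments_quadraticForm A).add (HasAllMoments.const (-A.trace))
  have hsplit (w : κ → ℝ) : 2 * (H w * (a ⬝ᵥ b + w ⬝ᵥ A *ᵥ w))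
      = 2 * (a ⬝ᵥ b + A.trace) * H w + 2 * (H w * (w ⬝ᵥ A *ᵥ w - A.trace)) := by ring
  have hmean : ∫ w, 2 * (H w * (a ⬝ᵥ b + w ⬝ᵥ A *ᵥ w)) ∂gaussVec κ
      = nextTrace (a ⬝ᵥ a) (b ⬝ᵥ b) (a ⬝ᵥ b) A.trace
        + 2 * ∫ w, H w * (w ⬝ᵥ A *ᵥ w - A.trace) ∂gaussVec κ := by
    simp_rw [hsplit]
    rw [integral_add (hHmoments.integrable.const_mul _)
      ((hHmoments.mul hcentered).integrable.const_mul _), integral_const_mul, integral_const_mul,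
      integral_heaviside_mul_heaviside ha hb, nextTrace, cosine]
    ring
  have hbound := abs_integral_mul_sub_integral_le (h := H)
    (fun w => abs_heaviside_mul_heaviside_le_one _ _) (hasAllMoments_quadraticForm A).memLp_two
  rw [integral_quadraticForm] at hbound
  rw [hmean, add_sub_cancel_left, abs_mul, abs_two]
  exact mul_le_mul_of_nonneg_left
    (hbound.trans (Real.sqrt_le_sqrt (variance_quadraticForm_le A))) zero_le_two

lemma integral_heaviside_mul_quadraticForm_sq_le (a b : κ → ℝ) (A : Matrix κ κ ℝ) (c : ℝ) :
    ∫ w, (2 * (heaviside (w ⬝ᵥ a) * heaviside (w ⬝ᵥ b) * (c + w ⬝ᵥ A *ᵥ w))) ^ 2 ∂gaussVec κ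
      ≤ 4 * ((c + A.trace) ^ 2 + 2 * frobSq A) := by
  have hq : HasAllMoments (fun w => w ⬝ᵥ A *ᵥ w) (gaussVec κ) := hasAllMoments_quadraticForm A
  have hcq : HasAllMoments (fun w => c + w ⬝ᵥ A *ᵥ w) (gaussVec κ) := (HasAllMoments.const c).add hq
  have hvar : ∫ w, (c + w ⬝ᵥ A *ᵥ w) ^ 2 ∂gaussVec κ ≤ (c + A.trace) ^ 2 + 2 * frobSq A := by
    have h := variance_const_add hq.memLp_two.aestronglyMeasurable c
    rw [variance_eq_sub hcq.memLp_two, integral_add (integrable_const _) hq.integrable,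
      integral_quadraticForm, integral_const, probReal_univ, one_smul] at h
    simp only [Pi.pow_apply] at h
    linarith [variance_quadraticForm_le A]
  calc ∫ w, (2 * (heaviside (w ⬝ᵥ a) * heaviside (w ⬝ᵥ b) * (c + w ⬝ᵥ A *ᵥ w))) ^ 2 ∂gaussVec κ
      ≤ ∫ w, 4 * (c + w ⬝ᵥ A *ᵥ w) ^ 2 ∂gaussVec κ := by
        refine integral_mono ((hasAllMoments_heaviside_mul_quadraticForm a b A c).pow 2).integrable
          ((hcq.pow 2).const_mul 4).integrable fun w => ?_
        have hH := (sq_le_one_iff_abs_le_one _).2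
          (abs_heaviside_mul_heaviside_le_one (w ⬝ᵥ a) (w ⬝ᵥ b))
        have := mul_le_mul_of_nonneg_right hH (sq_nonneg (c + w ⬝ᵥ A *ᵥ w))
        dsimp only
        linarith
    _ ≤ 4 * ((c + A.trace) ^ 2 + 2 * frobSq A) := by
        rw [integral_const_mul]
        exact mul_le_mul_of_nonneg_left hvar zero_le_four

lemma gaussMat_abs_trace_stepMat_sub_ge_le {a b : κ → ℝ} (ha : 0 < a ⬝ᵥ a) (hb : 0 < b ⬝ᵥ b)
    (A : Matrix κ κ ℝ) (hm : 0 < m) {ε : ℝ} (hε : 0 < ε) :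
    gaussMat m κ {W | ε + 2 * √(2 * frobSq A)
        ≤ |(stepMat W a b A).trace - nextTrace (a ⬝ᵥ a) (b ⬝ᵥ b) (a ⬝ᵥ b) A.trace|}
      ≤ ENNReal.ofReal (4 * ((a ⬝ᵥ b + A.trace) ^ 2 + 2 * frobSq A) / (m * ε ^ 2)) := by
  have hmean := abs_integral_heaviside_mul_quadraticForm_sub_le ha hb A
  have hcheb := measure_average_pi_sub_integral_ge_le
    (hasAllMoments_heaviside_mul_quadraticForm a b A (a ⬝ᵥ b)).memLp_two hm hε
  simp_rw [← trace_stepMat] at hcheb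
  refine (measure_mono fun W hW => ?_).trans
    (hcheb.trans (ENNReal.ofReal_le_ofReal ?_))
  · rw [Set.mem_ofPred_eq] at hW ⊢
    exact le_of_add_le_add_right
      (hW.trans ((abs_sub_le _ _ _).trans (add_le_add_right hmean _)))
  · gcongr
    exact integral_heaviside_mul_quadraticForm_sq_le a b A _

lemma hasAllMoments_bilinearForm_rows (A : Matrix κ κ ℝ) (i j : Fin m) :
    HasAllMoments (fun W => W i ⬝ᵥ A *ᵥ W j) (gaussMat m κ) := by
  simp_rw [dotProduct_mulVec_eq_sum]
  exact HasAllMoments.sum fun k _ => HasAllMoments.sum fun l _ =>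
    (((hasAllMoments_coord k).comp (measurePreserving_row i)).mul
      ((hasAllMoments_coord l).comp (measurePreserving_row j))).const_mul _

lemma stepMat_apply_sq_le (W : Fin m → κ → ℝ) (a b : κ → ℝ) (A : Matrix κ κ ℝ) (i j : Fin m) :
    stepMat W a b A i j ^ 2
      ≤ 8 / m ^ 2 * ((if i = j then (a ⬝ᵥ b) ^ 2 else 0) + (W i ⬝ᵥ A *ᵥ W j) ^ 2) := by
  have hH := (sq_le_one_iff_abs_le_one _).2
    (abs_heaviside_mul_heaviside_le_one (W i ⬝ᵥ a) (W j ⬝ᵥ b))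
  have hif : (if i = j then (a ⬝ᵥ b) ^ 2 else 0) = (if i = j then a ⬝ᵥ b else 0) ^ 2 := by
    split_ifs <;> simp
  rw [stepMat, Matrix.of_apply, hif, mul_pow, mul_pow, div_pow]
  set x : ℝ := if i = j then a ⬝ᵥ b else 0
  set y := W i ⬝ᵥ A *ᵥ W j
  calc (2 : ℝ) ^ 2 / (m : ℝ) ^ 2 * (heaviside (W i ⬝ᵥ a) * heaviside (W j ⬝ᵥ b)) ^ 2 * (x + y) ^ 2
      ≤ 2 ^ 2 / (m : ℝ) ^ 2 * 1 * (2 * (x ^ 2 + y ^ 2)) := by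
        gcongr
        exact add_sq_le
    _ = 8 / m ^ 2 * (x ^ 2 + y ^ 2) := by ring

lemma hasAllMoments_stepMat_sq_bound (A : Matrix κ κ ℝ) (c : ℝ) (i j : Fin m) :
    HasAllMoments (fun W => 8 / (m : ℝ) ^ 2 * (c + (W i ⬝ᵥ A *ᵥ W j) ^ 2)) (gaussMat m κ) :=
  ((HasAllMoments.const _).add ((hasAllMoments_bilinearForm_rows A i j).pow 2)).const_mul _

end Concentration

section Frobenius

variable {m : ℕ} {κ : Type*} [Fintype κ]

lemma integral_sum_stepMat_sq_bound_le (a b : κ → ℝ) (A : Matrix κ κ ℝ) (hm : 0 < m) :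
    ∫ W, ∑ i, ∑ j, 8 / (m : ℝ) ^ 2
        * ((if i = j then (a ⬝ᵥ b) ^ 2 else 0) + (W i ⬝ᵥ A *ᵥ W j) ^ 2) ∂gaussMat m κ
      ≤ 8 * (frobSq A + ((a ⬝ᵥ b) ^ 2 + A.trace ^ 2 + frobSq A) / m) := by
  have : (0 : ℝ) < m := Nat.cast_pos.2 hm
  have hint (c : ℝ) (i j : Fin m) := (hasAllMoments_stepMat_sq_bound A c i j).integrable
  rw [integral_finsetSum _ fun i _ => integrable_finsetSum _ fun j _ => hint _ i j]
  simp_rw [integral_finsetSum _ fun j _ => hint _ _ j, integral_const_mul]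
  calc _ ≤ ∑ i : Fin m, ∑ j : Fin m, 8 / (m : ℝ) ^ 2 * (frobSq A
          + if i = j then (a ⬝ᵥ b) ^ 2 + A.trace ^ 2 + frobSq A else 0) := by
        gcongr with i _ j _
        rw [integral_add (integrable_const _)
          ((hasAllMoments_bilinearForm_rows A i j).pow 2).integrable, integral_const, probReal_univ,
          one_smul]
        have := integral_bilinearForm_rows_sq_le A i j
        split_ifs at this ⊢ <;> linarith
    _ = _ := by
        simp only [← Finset.mul_sum, Finset.sum_add_distrib, Finset.sum_ite_eq, Finset.mem_univ,
          if_true, Finset.sum_const, Finset.card_univ, Fintype.card_fin, nsmul_eq_mul]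
        field_simp

lemma gaussMat_frobSq_stepMat_ge_le (a b : κ → ℝ) (A : Matrix κ κ ℝ) (hm : 0 < m) {ε : ℝ}
    (hε : 0 < ε) :
    gaussMat m κ {W | ε ≤ frobSq (stepMat W a b A)}
      ≤ ENNReal.ofReal (8 * (frobSq A + ((a ⬝ᵥ b) ^ 2 + A.trace ^ 2 + frobSq A) / m) / ε) := by
  set Y : (Fin m → κ → ℝ) → ℝ := fun W => ∑ i, ∑ j, 8 / (m : ℝ) ^ 2
      * ((if i = j then (a ⬝ᵥ b) ^ 2 else 0) + (W i ⬝ᵥ A *ᵥ W j) ^ 2)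
  have hY (W : Fin m → κ → ℝ) : frobSq (stepMat W a b A) ≤ Y W :=
    Finset.sum_le_sum fun i _ => Finset.sum_le_sum fun j _ => stepMat_apply_sq_le W a b A i j
  have hY_int : Integrable Y (gaussMat m κ) :=
    integrable_finsetSum _ fun i _ => integrable_finsetSum _ fun j _ =>
      (hasAllMoments_stepMat_sq_bound A _ i j).integrable
  have hmarkov := mul_meas_ge_le_integral_of_nonneg
    (ae_of_all _ fun W => (frobSq_nonneg _).trans (hY W)) hY_int ε
  calc gaussMat m κ {W | ε ≤ frobSq (stepMat W a b A)}
      ≤ gaussMat m κ {W | ε ≤ Y W} := measure_mono fun W hW => le_trans (α := ℝ) hW (hY W)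
    _ = ENNReal.ofReal ((gaussMat m κ).real {W | ε ≤ Y W}) :=
        (ENNReal.ofReal_toReal (measure_ne_top _ _)).symm
    _ ≤ _ := ENNReal.ofReal_le_ofReal <| (le_div_iff₀' hε).2 <|
        hmarkov.trans (integral_sum_stepMat_sq_bound_le a b A hm)

end Frobenius

/-- The statistics of a layer that have a limit for infinite width: the squared norms of the two
embeddings, their inner product, and the trace and squared Frobenius norm of the gradient matrix.
The Frobenius norm tends to zero, which is what makes the other statistics concentrate. -/
def stateStats {κ : Type*} [Fintype κ] (s : LayerState κ) : ℝ × ℝ × ℝ × ℝ × ℝ :=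
  (s.1 ⬝ᵥ s.1, s.2.1 ⬝ᵥ s.2.1, s.1 ⬝ᵥ s.2.1, s.2.2.trace, frobSq s.2.2)

/-- The limit of the statistics of the next layer, from the limit `x` of those of a layer. -/
def nextStats (x : ℝ × ℝ × ℝ × ℝ × ℝ) : ℝ × ℝ × ℝ × ℝ × ℝ :=
  (x.1, x.2.1, nextInner x.1 x.2.1 x.2.2.1, nextTrace x.1 x.2.1 x.2.2.1 x.2.2.2.1, 0)

lemma continuousAt_nextStats {x : ℝ × ℝ × ℝ × ℝ × ℝ} (hP : 0 < x.1) (hQ : 0 < x.2.1) :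
    ContinuousAt nextStats x := by
  have hcos : ContinuousAt (fun x : ℝ × ℝ × ℝ × ℝ × ℝ => x.2.2.1 / (√x.1 * √x.2.1)) x :=
    ContinuousAt.div (by fun_prop) (by fun_prop)
      (mul_ne_zero (Real.sqrt_ne_zero'.2 hP) (Real.sqrt_ne_zero'.2 hQ))
  have hcos0 := continuous_arcCos0.continuousAt.comp hcos
  have hcos1 := continuous_arcCos1.continuousAt.comp hcos
  simp only [Function.comp_def] at hcos0 hcos1
  unfold nextStats nextInner nextTrace
  fun_prop

/-- The constant in the failure probability of the concentration, up to an error `ε`, of the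
statistics of the next layer, from the statistics `x` of a layer. -/
def layerError (ε : ℝ) (x : ℝ × ℝ × ℝ × ℝ × ℝ) : ℝ :=
  12 * (x.1 * x.1 + x.2.1 * x.2.1 + x.1 * x.2.1) / ε ^ 2
    + 16 * ((x.2.2.1 + x.2.2.2.1) ^ 2 + 2 * x.2.2.2.2) / ε ^ 2
    + 8 * (x.2.2.1 ^ 2 + x.2.2.2.1 ^ 2 + x.2.2.2.2) / ε

lemma measure_union_le_add {α : Type*} [MeasurableSpace α] {μ : Measure α} {s t : Set α}
    {a b : ℝ≥0∞} (hs : μ s ≤ a) (ht : μ t ≤ b) : μ (s ∪ t) ≤ a + b :=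
  (measure_union_le s t).trans (add_le_add hs ht)

lemma gaussMat_dist_stateStats_stepState_ge_le {m : ℕ} {κ : Type*} [Fintype κ] {s : LayerState κ}
    (ha : 0 < s.1 ⬝ᵥ s.1) (hb : 0 < s.2.1 ⬝ᵥ s.2.1) (hm : 0 < m) {ε : ℝ}
    (hA : 2 * √(2 * frobSq s.2.2) ≤ ε / 2) (hε : 0 < ε) :
    gaussMat m κ {W | ε ≤ dist (stateStats (stepState W s)) (nextStats (stateStats s))}
      ≤ ENNReal.ofReal (8 * frobSq s.2.2 / ε + layerError ε (stateStats s) / m) := by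
  obtain ⟨a, b, A⟩ := s
  have : (0 : ℝ) < m := Nat.cast_pos.2 hm
  have haa := gaussMat_abs_stepVec_dotProduct_sub_ge_le a a hm hε
  have hbb := gaussMat_abs_stepVec_dotProduct_sub_ge_le b b hm hε
  have hab := gaussMat_abs_stepVec_dotProduct_sub_ge_le a b hm hε
  have htrace := gaussMat_abs_trace_stepMat_sub_ge_le ha hb A hm (half_pos hε)
  have hfrob := gaussMat_frobSq_stepMat_ge_le a b A hm hε
  rw [nextInner_self ha.le] at haa
  rw [nextInner_self hb.le] at hbb
  have := mul_pos ha hb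
  have hfrob0 := frobSq_nonneg A
  refine (measure_mono fun W hW => ?_).trans <|
    (measure_union_le_add haa <| measure_union_le_add hbb <| measure_union_le_add hab <|
      measure_union_le_add htrace hfrob).trans_eq ?_
  · simp only [Set.mem_ofPred_eq, stateStats, nextStats, stepState, Prod.dist_eq, le_max_iff,
      Real.dist_eq, sub_zero, abs_of_nonneg (frobSq_nonneg _)] at hW
    simp only [Set.mem_union, Set.mem_ofPred_eq]
    refine hW.imp_right <| Or.imp_right <| Or.imp_right <| Or.imp_left fun h => ?_
    exact le_trans (by linarith) h
  · rw [← ENNReal.ofReal_add, ← ENNReal.ofReal_add, ← ENNReal.ofReal_add, ← ENNReal.ofReal_add]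
    · congr 1
      simp only [layerError, stateStats]
      field_simp
      ring
    all_goals positivity

lemma tendsto_layerError_bound (ε : ℝ) {x : ℝ × ℝ × ℝ × ℝ × ℝ}
    (hF : x.2.2.2.2 = 0) :
    Tendsto (fun p : ℕ × (ℝ × ℝ × ℝ × ℝ × ℝ) => 8 * p.2.2.2.2.2 / ε + layerError ε p.2 / p.1)
      (atTop ×ˢ 𝓝 x) (𝓝 0) := by
  have hfrob : Tendsto (fun y : ℝ × ℝ × ℝ × ℝ × ℝ => 8 * y.2.2.2.2 / ε) (𝓝 x) (𝓝 0) :=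
    (by fun_prop : Continuous fun y : ℝ × ℝ × ℝ × ℝ × ℝ => 8 * y.2.2.2.2 / ε).tendsto' _ _
      (by simp [hF])
  have herror : Continuous (layerError ε) := by
    unfold layerError
    fun_prop
  simpa using (hfrob.comp tendsto_snd).add
    (((herror.tendsto x).comp tendsto_snd).div_atTop
      (tendsto_natCast_atTop_atTop.comp tendsto_fst))

lemma eventually_gaussMat_dist_nextStats_ge_le {x : ℝ × ℝ × ℝ × ℝ × ℝ} (hP : 0 < x.1)
    (hQ : 0 < x.2.1) (hF : x.2.2.2.2 = 0) {ε : ℝ} (hε : 0 < ε) {η : ℝ≥0∞} (hη : 0 < η) :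
    ∀ᶠ p : ℕ × (ℝ × ℝ × ℝ × ℝ × ℝ) in atTop ×ˢ 𝓝 x, ∀ (κ : Type) [Fintype κ] (s : LayerState κ),
      stateStats s = p.2 →
        gaussMat p.1 κ {W | ε ≤ dist (stateStats (stepState W s)) (nextStats x)} ≤ η := by
  have hsmall : ∀ᶠ y in 𝓝 x, 2 * √(2 * y.2.2.2.2) < ε / 2 / 2 :=
    (by fun_prop : Continuous fun y : ℝ × ℝ × ℝ × ℝ × ℝ => 2 * √(2 * y.2.2.2.2)).continuousAt
      |>.eventually_lt_const (by simp [hF, hε])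
  have hbound := ENNReal.continuous_ofReal.tendsto _ |>.comp
    (tendsto_layerError_bound (ε / 2) hF)
  rw [ENNReal.ofReal_zero] at hbound
  filter_upwards [hbound.eventually_le_const hη, tendsto_fst.eventually (eventually_gt_atTop 0),
    tendsto_snd.eventually hsmall, tendsto_snd.eventually (continuousAt_fst.eventually_const_lt hP),
    tendsto_snd.eventually ((continuousAt_fst.comp continuousAt_snd).eventually_const_lt hQ),
    tendsto_snd.eventually
      ((continuousAt_nextStats hP hQ).eventually (Metric.ball_mem_nhds _ (half_pos hε)))]
    with ⟨m, y⟩ hη hm hy hyP hyQ hclose κ _ s hs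
  subst hs
  refine (measure_mono fun W hW => ?_).trans
    ((gaussMat_dist_stateStats_stepState_ge_le hyP hyQ hm hy.le (half_pos hε)).trans hη)
  rw [Set.mem_ofPred_eq] at hW ⊢
  have := dist_triangle (stateStats (stepState W s)) (nextStats (stateStats s)) (nextStats x)
  have : dist (nextStats (stateStats s)) (nextStats x) < ε / 2 := hclose
  linarith

section Nondegenerate

variable {κ : Type*} [Fintype κ]

lemma gaussVec_dotProduct_eq_zero {a : κ → ℝ} (ha : a ≠ 0) :
    gaussVec κ {w | w ⬝ᵥ a = 0} = 0 := by
  have hvar : (a ⬝ᵥ a).toNNReal ≠ 0 := by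
    simpa using ((dotProduct_self_nonneg a).lt_of_ne' (dotProduct_self_eq_zero.not.2 ha))
  have := nullSingletonClass_gaussianReal (μ := 0) hvar
  have hmap := measure_singleton (μ := gaussianReal 0 (a ⬝ᵥ a).toNNReal) 0
  rwa [← gaussVec_map_dotProduct, Measure.map_apply (by fun_prop) (measurableSet_singleton 0)]
    at hmap

lemma ae_gaussMat_forall_dotProduct_ne_zero (m : ℕ) {a : κ → ℝ} (ha : a ≠ 0) :
    ∀ᵐ W ∂gaussMat m κ, ∀ i, W i ⬝ᵥ a ≠ 0 :=
  ae_all_iff.2 fun i => (measurePreserving_row i).quasiMeasurePreserving.ae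
    (p := fun w => w ⬝ᵥ a ≠ 0) (by simpa [ae_iff] using gaussVec_dotProduct_eq_zero ha)

lemma gaussVec_abs_quadraticForm_sub_trace_ge_le (A : Matrix κ κ ℝ) {ε : ℝ} (hε : 0 < ε) :
    gaussVec κ {w | ε ≤ |w ⬝ᵥ A *ᵥ w - A.trace|} ≤ ENNReal.ofReal (2 * frobSq A / ε ^ 2) := by
  have hcheb := meas_ge_le_variance_div_sq (hasAllMoments_quadraticForm A).memLp_two hε
  rw [integral_quadraticForm] at hcheb
  refine hcheb.trans (ENNReal.ofReal_le_ofReal ?_)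
  gcongr
  exact variance_quadraticForm_le A

end Nondegenerate

/-! ### The parameter gradients -/

lemma hasDerivAt_relu {z : ℝ} (hz : z ≠ 0) : HasDerivAt relu (heaviside z) z := by
  rcases lt_or_gt_of_ne hz with h | h
  · rw [heaviside_of_nonpos h.le]
    refine (hasDerivAt_const z (0 : ℝ)).congr_of_eventuallyEq ?_
    filter_upwards [gt_mem_nhds h] with y hy using max_eq_left (le_of_lt hy)
  · rw [heaviside_of_pos h]
    refine (hasDerivAt_id z).congr_of_eventuallyEq ?_
    filter_upwards [lt_mem_nhds h] with y hy using max_eq_right (le_of_lt hy)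

section LinearUnit

variable {ι κ : Type*} [Fintype ι] [DecidableEq ι] [Fintype κ]

/-- The gradient in `v` of a linear unit `∑ k, v (e k) * f k v`, whose weights are the parameters
with indices `e k`, from the values `u k` of its weights, the values `a k` of its inputs `f k` and
their gradients `g k`. -/
def linearUnitGrad (e : κ → ι) (u a : κ → ℝ) (g : κ → EuclideanSpace ℝ ι) : EuclideanSpace ℝ ι :=
  ∑ k, (u k • g k + a k • EuclideanSpace.single (e k) (1 : ℝ))

lemma hasFDerivAt_coord (w : EuclideanSpace ℝ ι) (i : ι) :
    HasFDerivAt (fun v : EuclideanSpace ℝ ι => v i)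
      (innerSL ℝ (EuclideanSpace.single i (1 : ℝ))) w := by
  have h := (EuclideanSpace.proj i : EuclideanSpace ℝ ι →L[ℝ] ℝ).hasFDerivAt (x := w)
  convert! h using 1
  ext v
  simp [EuclideanSpace.inner_single_left]

lemma hasFDerivAt_linearUnit {w : EuclideanSpace ℝ ι} (e : κ → ι)
    {f : κ → EuclideanSpace ℝ ι → ℝ} {g : κ → EuclideanSpace ℝ ι}
    (hf : ∀ k, HasFDerivAt (f k) (innerSL ℝ (g k)) w) :
    HasFDerivAt (fun v => ∑ k, v (e k) * f k v)
      (innerSL ℝ (linearUnitGrad e (fun k => w (e k)) (fun k => f k w) g)) w := by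
  have h := HasFDerivAt.fun_sum (u := Finset.univ) fun k _ =>
    (hasFDerivAt_coord w (e k)).fun_mul (hf k)
  convert! h using 1
  simp only [linearUnitGrad, map_sum, map_add, map_smul]

lemma inner_linearUnitGrad (e e' : κ → ι) (u v a b : κ → ℝ) (g g' : κ → EuclideanSpace ℝ ι)
    (hg : ∀ k l, g k (e' l) = 0) (hg' : ∀ k l, g' k (e l) = 0) :
    inner ℝ (linearUnitGrad e u a g) (linearUnitGrad e' v b g')
      = (∑ k, ∑ l, if e k = e' l then a k * b l else 0)
        + u ⬝ᵥ (Matrix.of fun k l => inner ℝ (g k) (g' l)) *ᵥ v := by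
  rw [dotProduct_mulVec_eq_sum, linearUnitGrad, linearUnitGrad, sum_inner, ← Finset.sum_add_distrib]
  refine Finset.sum_congr rfl fun k _ => ?_
  rw [inner_sum, ← Finset.sum_add_distrib]
  refine Finset.sum_congr rfl fun l _ => ?_
  simp only [inner_add_left, inner_add_right, real_inner_smul_left, real_inner_smul_right,
    EuclideanSpace.inner_single_left, EuclideanSpace.inner_single_right, hg, hg', map_one, one_mul,
    mul_zero, Matrix.of_apply, add_zero, PiLp.smul_apply, conj_trivial, PiLp.single_apply,
    eq_comm (a := e' l), smul_eq_mul]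
  split_ifs <;> ring

end LinearUnit

section NetworkGradient

variable {d m L : ℕ}

/-- The parameter gradients of the entries of the `l`-embedding. -/
def embGrad (w : Params d m L) (x : EuclideanSpace ℝ (Fin d)) :
    (l : ℕ) → l ≤ L → Fin (width d m l) → Params d m L
  | 0, _ => fun _ => 0
  | l + 1, h => fun i =>
      (√2 / √m * heaviside (hiddenWeight w ⟨l, h⟩ i ⬝ᵥ embedding w x l (Nat.le_of_succ_le h))) •
        linearUnitGrad (fun k => Sum.inl ⟨⟨l, h⟩, (i, k)⟩) (hiddenWeight w ⟨l, h⟩ i)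
          (embedding w x l (Nat.le_of_succ_le h)) (embGrad w x l (Nat.le_of_succ_le h))

/-- The preactivations of the layers before `l` at the input `x` are all nonzero, so that the
embeddings up to the `l`-th are differentiable in the parameters. -/
def NonzeroPreact (w : Params d m L) (x : EuclideanSpace ℝ (Fin d)) (l : ℕ) : Prop :=
  ∀ (k : ℕ) (hk : k < L), k < l → ∀ i, hiddenWeight w ⟨k, hk⟩ i ⬝ᵥ embedding w x k hk.le ≠ 0

lemma hasFDerivAt_embedding {w : Params d m L} {x : EuclideanSpace ℝ (Fin d)} :
    ∀ (l : ℕ) (h : l ≤ L), NonzeroPreact w x l → ∀ i,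
      HasFDerivAt (fun v : Params d m L => embedding v x l h i) (innerSL ℝ (embGrad w x l h i)) w
  | 0, _, _, i => by
    simp only [embedding, embGrad, map_zero]
    exact hasFDerivAt_const _ _
  | l + 1, h, hnz, i => by
    have ih := hasFDerivAt_embedding l (Nat.le_of_succ_le h)
      (fun k hk hkl => hnz k hk (Nat.lt_succ_of_lt hkl))
    have hpreact := hasFDerivAt_linearUnit
      (fun k => (Sum.inl ⟨⟨l, h⟩, (i, k)⟩ : ParamIndex d m L)) ih
    have hrelu := ((hasDerivAt_relu (hnz l h l.lt_succ_self i)).comp_hasFDerivAt w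
      (f := fun v : Params d m L => hiddenWeight v ⟨l, h⟩ i ⬝ᵥ
        embedding v x l (Nat.le_of_succ_le h)) hpreact).const_mul (√2 / √m)
    convert! hrelu using 1
    rw [embGrad, map_smul, mul_smul]
    rfl

lemma modelGradient_eq {w : Params d m L} {x : EuclideanSpace ℝ (Fin d)}
    (hnz : NonzeroPreact w x L) :
    modelGradient w x = linearUnitGrad Sum.inr (outputWeight w) (embedding w x L le_rfl)
      (embGrad w x L le_rfl) :=
  HasGradientAt.gradient (hasFDerivAt_linearUnit (fun k => (Sum.inr k : ParamIndex d m L))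
    (hasFDerivAt_embedding L le_rfl hnz))

lemma embGrad_apply_inl (w : Params d m L) (x : EuclideanSpace ℝ (Fin d)) :
    ∀ (l : ℕ) (h : l ≤ L) (i) (k : Fin L) (p), l ≤ k → embGrad w x l h i (Sum.inl ⟨k, p⟩) = 0
  | 0, _, _, _, _, _ => rfl
  | l + 1, h, i, k, p, hk => by
    have ih j := embGrad_apply_inl w x l (Nat.le_of_succ_le h) j k p (Nat.le_of_succ_le hk)
    have hne : k ≠ ⟨l, h⟩ := fun e => absurd (congrArg Fin.val e) (Nat.ne_of_gt hk)
    have hne' (j) : (Sum.inl ⟨k, p⟩ : ParamIndex d m L) ≠ Sum.inl ⟨⟨l, h⟩, (i, j)⟩ := fun e =>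
      hne (congrArg Sigma.fst (Sum.inl.inj e))
    simp [embGrad, linearUnitGrad, ih, hne']

lemma embGrad_apply_inr (w : Params d m L) (x : EuclideanSpace ℝ (Fin d)) :
    ∀ (l : ℕ) (h : l ≤ L) (i) (k), embGrad w x l h i (Sum.inr k) = 0
  | 0, _, _, _ => rfl
  | l + 1, h, i, k => by
    have ih j := embGrad_apply_inr w x l (Nat.le_of_succ_le h) j k
    simp [embGrad, linearUnitGrad, ih]

/-- The state of layer `l` of the network with parameters `w`, for the inputs `x` and `y`. -/
def layerState (w : Params d m L) (x y : EuclideanSpace ℝ (Fin d)) (l : ℕ) (h : l ≤ L) :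
    LayerState (Fin (width d m l)) :=
  (embedding w x l h, embedding w y l h,
    Matrix.of fun i j => inner ℝ (embGrad w x l h i) (embGrad w y l h j))

lemma layerState_zero (w : Params d m L) (x y : EuclideanSpace ℝ (Fin d)) (h : 0 ≤ L) :
    layerState w x y 0 h = (fun i => x i, fun i => y i, 0) := by
  simp only [layerState, embGrad, inner_zero_left]
  rfl

lemma layerState_succ (w : Params d m L) (x y : EuclideanSpace ℝ (Fin d)) (l : ℕ)
    (h : l + 1 ≤ L) :
    layerState w x y (l + 1) h = stepState (m := m) (hiddenWeight w ⟨l, h⟩)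
      (layerState w x y l (Nat.le_of_succ_le h)) := by
  refine Prod.ext rfl (Prod.ext rfl (Matrix.ext fun i j => ?_))
  simp only [layerState, stepState, stepMat, embGrad, Matrix.of_apply]
  rw [real_inner_smul_left, real_inner_smul_right, inner_linearUnitGrad _ _ _ _ _ _ _ _
    (fun k p => embGrad_apply_inl w x l _ k ⟨l, h⟩ _ le_rfl)
    (fun k p => embGrad_apply_inl w y l _ k ⟨l, h⟩ _ le_rfl), ← mul_assoc, mul_mul_mul_comm,
    sqrt_two_div_sqrt_mul_self]
  have hweights (a b : Fin (width d m l) → ℝ) :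
      (∑ k, ∑ p, if (Sum.inl ⟨⟨l, h⟩, (i, k)⟩ : ParamIndex d m L) = Sum.inl ⟨⟨l, h⟩, (j, p)⟩
        then a k * b p else 0) = if i = j then a ⬝ᵥ b else 0 := by
    by_cases hij : i = j
    · simp [hij, dotProduct]
    · simp [hij]
  rw [hweights]
  rfl

lemma ntkMatrix_apply {n : ℕ} {w : Params d m L} {x : Fin n → EuclideanSpace ℝ (Fin d)}
    {i j : Fin n} (hi : NonzeroPreact w (x i) L) (hj : NonzeroPreact w (x j) L) :
    ntkMatrix w x i j = embedding w (x i) L le_rfl ⬝ᵥ embedding w (x j) L le_rfl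
      + outputWeight w ⬝ᵥ (layerState w (x i) (x j) L le_rfl).2.2 *ᵥ outputWeight w := by
  rw [ntkMatrix, Matrix.of_apply, modelGradient_eq hi, modelGradient_eq hj,
    inner_linearUnitGrad _ _ _ _ _ _ _ _ (fun k p => embGrad_apply_inr w (x i) L _ k _)
      (fun k p => embGrad_apply_inr w (x j) L _ k _)]
  simp [dotProduct, layerState]

end NetworkGradient

/-! ### Independence of the weights of different layers -/

section Independence

variable {Ω : Type*} [MeasurableSpace Ω] {μ : Measure Ω}

lemma indepFun_of_dependsOn {ι γ δ : Type*} [Finite ι] {β : ι → Type*}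
    [∀ i, MeasurableSpace (β i)] [∀ i, Nonempty (β i)] [MeasurableSpace γ] [MeasurableSpace δ]
    {X : ∀ i, Ω → β i} (hindep : iIndepFun X μ) (hX : ∀ i, Measurable (X i))
    {f : (∀ i, β i) → γ} {g : (∀ i, β i) → δ} (hf : Measurable f) (hg : Measurable g)
    {s t : Set ι} (hst : Disjoint s t) (hfs : DependsOn f s) (hgt : DependsOn g t) :
    IndepFun (fun ω => f fun i => X i ω) (fun ω => g fun i => X i ω) μ := by
  classical
  cases nonempty_fintype ι
  obtain ⟨base⟩ : Nonempty (∀ i, β i) := inferInstance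
  let extend (u : Set ι) (z : ∀ i : u.toFinset, β i) (i : ι) : β i :=
    if hi : i ∈ u.toFinset then z ⟨i, hi⟩ else base i
  have hextend (u : Set ι) : Measurable (extend u) := by
    refine measurable_pi_lambda _ fun i => ?_
    by_cases hi : i ∈ u.toFinset
    · simpa only [extend, hi, dite_true] using measurable_pi_apply _
    · simpa only [extend, hi, dite_false] using measurable_const
  have hX_extend (u : Set ι) (ω : Ω) {i : ι} (hi : i ∈ u) :
      extend u (fun j => X j ω) i = X i ω := dif_pos (Set.mem_toFinset.2 hi)
  have := (hindep.indepFun_finset s.toFinset t.toFinset (by simpa using hst) hX).comp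
    (hf.comp (hextend s)) (hg.comp (hextend t))
  convert! this using 1
  · exact funext fun ω => hfs fun i hi => (hX_extend s ω hi).symm
  · exact funext fun ω => hgt fun i hi => (hX_extend t ω hi).symm

lemma measure_prodMk_mem_le_of_indepFun [IsProbabilityMeasure μ] {α β : Type*} [MeasurableSpace α]
    [MeasurableSpace β] {X : Ω → α} {Y : Ω → β} (hX : Measurable X) (hY : Measurable Y)
    (hindep : IndepFun X Y μ) {G : Set α} (hG : MeasurableSet G) {B : Set (α × β)}
    (hB : MeasurableSet B) {c : ℝ≥0∞} (hc : ∀ x ∈ G, μ.map Y {y | (x, y) ∈ B} ≤ c) :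
    μ {ω | (X ω, Y ω) ∈ B} ≤ μ {ω | X ω ∉ G} + c := by
  have := Measure.isProbabilityMeasure_map (μ := μ) hX.aemeasurable
  have := Measure.isProbabilityMeasure_map (μ := μ) hY.aemeasurable
  have hbound (x : α) : μ.map Y {y | (x, y) ∈ B} ≤ Gᶜ.indicator 1 x + c := by
    by_cases hx : x ∈ G
    · exact (hc x hx).trans le_add_self
    · simpa [hx] using le_add_right prob_le_one
  calc μ {ω | (X ω, Y ω) ∈ B}
      = (μ.map X).prod (μ.map Y) B := by
        rw [← hindep.map_prod_eq_prod_map_map hX.aemeasurable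
          hY.aemeasurable, Measure.map_apply (hX.prodMk hY) hB]
        rfl
    _ = ∫⁻ x, μ.map Y {y | (x, y) ∈ B} ∂μ.map X := Measure.prod_apply hB
    _ ≤ ∫⁻ x, Gᶜ.indicator 1 x + c ∂μ.map X := lintegral_mono hbound
    _ = μ {ω | X ω ∉ G} + c := by
        rw [lintegral_add_right _ measurable_const, lintegral_indicator_one hG.compl,
          Measure.map_apply hX hG.compl, lintegral_const, measure_univ, mul_one]
        rfl

end Independence

section Measurability

variable {Ω : Type*} [MeasurableSpace Ω] {m : ℕ} {κ : Type*}

instance : MeasurableSpace (Matrix κ κ ℝ) := inferInstanceAs (MeasurableSpace (κ → κ → ℝ))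

lemma measurable_matrix_iff {A : Ω → Matrix κ κ ℝ} :
    Measurable A ↔ ∀ i j, Measurable fun ω => A ω i j :=
  measurable_pi_iff.trans (forall_congr' fun _ => measurable_pi_iff)

variable [Fintype κ]

lemma measurable_stepState {W : Ω → Fin m → κ → ℝ} {s : Ω → LayerState κ} (hW : Measurable W)
    (hs : Measurable s) : Measurable fun ω => stepState (W ω) (s ω) := by
  have hrow (i : Fin m) : Measurable fun ω => W ω i := by fun_prop
  have := measurable_matrix_iff.1 hs.snd.snd
  have hquad (i j : Fin m) : Measurable fun ω => W ω i ⬝ᵥ (s ω).2.2 *ᵥ W ω j := by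
    simp_rw [dotProduct_mulVec_eq_sum]
    fun_prop
  have hvec {a : Ω → κ → ℝ} (ha : Measurable a) : Measurable fun ω => stepVec (W ω) (a ω) := by
    unfold stepVec
    fun_prop
  refine (hvec hs.fst).prodMk ((hvec hs.snd.fst).prodMk (measurable_matrix_iff.2 fun i j => ?_))
  simp only [stepMat, Matrix.of_apply]
  split_ifs <;> fun_prop

lemma measurable_stateStats : Measurable (stateStats (κ := κ)) := by
  have := measurable_matrix_iff.1 (measurable_snd.comp measurable_snd :
    Measurable fun s : LayerState κ => s.2.2)
  unfold stateStats Matrix.trace Matrix.diag frobSq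
  fun_prop

end Measurability

section InitLaw

variable {d m L : ℕ}

lemma gaussVec_map_curry (m : ℕ) (κ : Type*) [Fintype κ] :
    (gaussVec (Fin m × κ)).map Function.curry = gaussMat m κ := by
  have h := Measure.infinitePi_map_curry (fun (_ : Fin m) (_ : κ) => gaussianReal 0 1)
  simp_rw [Measure.infinitePi_eq_pi] at h
  exact h

instance : IsProbabilityMeasure (initLaw d m L) :=
  Measure.isProbabilityMeasure_map (by fun_prop)

lemma initLaw_map_ofLp :
    (initLaw d m L).map (fun w i => w i) = gaussVec (ParamIndex d m L) :=
  (MeasurableEquiv.toLp 2 (ParamIndex d m L → ℝ)).map_symm_map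

lemma initLaw_map_coord (i : ParamIndex d m L) :
    (initLaw d m L).map (fun w => w i) = gaussianReal 0 1 := by
  rw [← (measurePreserving_eval (fun _ : ParamIndex d m L => gaussianReal 0 1) i).map_eq,
    ← gaussVec, ← initLaw_map_ofLp, Measure.map_map (by fun_prop) (by fun_prop)]
  rfl

lemma iIndepFun_initLaw_coord :
    iIndepFun (fun (i : ParamIndex d m L) (w : Params d m L) => w i) (initLaw d m L) := by
  refine (iIndepFun_iff_map_fun_eq_pi_map fun i => by fun_prop).2 ?_
  simp_rw [initLaw_map_coord]
  exact initLaw_map_ofLp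

lemma initLaw_map_comp {κ : Type*} [Fintype κ] {e : κ → ParamIndex d m L}
    (he : Function.Injective e) : (initLaw d m L).map (fun w k => w (e k)) = gaussVec κ := by
  rw [(iIndepFun_iff_map_fun_eq_pi_map fun k => by fun_prop).1
    (iIndepFun_initLaw_coord.precomp he)]
  simp_rw [initLaw_map_coord]
  rfl

lemma initLaw_map_outputWeight :
    (initLaw d m L).map outputWeight = gaussVec (Fin (width d m L)) :=
  initLaw_map_comp Sum.inr_injective

lemma measurable_hiddenWeight (l : Fin L) :
    Measurable fun (w : Params d m L) (i : Fin m) => hiddenWeight w l i := by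
  refine measurable_pi_lambda _ fun i => measurable_pi_lambda _ fun k => ?_
  simp only [hiddenWeight]
  fun_prop

lemma initLaw_map_hiddenWeight (l : Fin L) :
    (initLaw d m L).map (fun w (i : Fin m) => hiddenWeight w l i)
      = gaussMat m (Fin (width d m l)) := by
  have hinj : Function.Injective
      fun q : Fin m × Fin (width d m l) => (Sum.inl ⟨l, q⟩ : ParamIndex d m L) :=
    Sum.inl_injective.comp sigma_mk_injective
  rw [← gaussVec_map_curry, ← initLaw_map_comp hinj, Measure.map_map (by fun_prop) (by fun_prop)]
  rfl

end InitLaw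

/-! ### The infinite-width limit -/

section LayerIndependence

variable {d m L : ℕ}

/-- The indices of the parameters that the layers up to the `l`-th read: the entries of the weight
matrices leaving the layers `k < l`. -/
def weightsBefore (d m L l : ℕ) : Set (ParamIndex d m L) :=
  {p | ∃ (k : Fin L) (q : Fin (width d m (k + 1)) × Fin (width d m k)),
    (k : ℕ) < l ∧ p = Sum.inl ⟨k, q⟩}

lemma layerState_congr {x y : EuclideanSpace ℝ (Fin d)} {w w' : Params d m L} {l : ℕ} (h : l ≤ L)
    (hw : ∀ p ∈ weightsBefore d m L l, w p = w' p) :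
    layerState w x y l h = layerState w' x y l h := by
  induction l with
  | zero => rw [layerState_zero, layerState_zero]
  | succ l ih =>
    have hweight : hiddenWeight w ⟨l, h⟩ = hiddenWeight w' ⟨l, h⟩ :=
      Matrix.ext fun i j => hw _ ⟨⟨l, h⟩, (i, j), l.lt_succ_self, rfl⟩
    rw [layerState_succ, layerState_succ, hweight, ih (Nat.le_of_succ_le h)]
    rintro p ⟨k, q, hk, rfl⟩
    exact hw _ ⟨k, q, hk.trans l.lt_succ_self, rfl⟩

variable (x y : EuclideanSpace ℝ (Fin d))

lemma measurable_layerState (l : ℕ) (h : l ≤ L) :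
    Measurable fun w : Params d m L => layerState w x y l h := by
  induction l with
  | zero => exact (funext fun w => layerState_zero w x y h) ▸ measurable_const
  | succ l ih =>
    simp only [layerState_succ]
    exact measurable_stepState (measurable_hiddenWeight ⟨l, h⟩) (ih (Nat.le_of_succ_le h))

lemma indepFun_layerState {l : ℕ} (h : l ≤ L) {γ : Type*} [MeasurableSpace γ]
    {g : Params d m L → γ} (hg : Measurable g) {t : Set (ParamIndex d m L)}
    (ht : Disjoint (weightsBefore d m L l) t)
    (hgt : DependsOn (fun u : ParamIndex d m L → ℝ => g (WithLp.toLp 2 u)) t) :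
    IndepFun (fun w => layerState w x y l h) g (initLaw d m L) :=
  indepFun_of_dependsOn
    (f := fun u : ParamIndex d m L → ℝ => layerState (WithLp.toLp 2 u) x y l h)
    iIndepFun_initLaw_coord (fun _ => by fun_prop)
    ((measurable_layerState x y l h).comp (by fun_prop)) (hg.comp (by fun_prop)) ht
    (fun _ _ huv => layerState_congr h huv) hgt

lemma indepFun_layerState_hiddenWeight {l : ℕ} (h : l < L) :
    IndepFun (fun w => layerState w x y l h.le) (fun w (i : Fin m) => hiddenWeight w ⟨l, h⟩ i)
      (initLaw d m L) := by
  refine indepFun_layerState x y h.le (measurable_hiddenWeight ⟨l, h⟩)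
    (t := Set.range fun q => Sum.inl ⟨⟨l, h⟩, q⟩) (Set.disjoint_left.2 ?_) fun u v huv => ?_
  · rintro _ ⟨k, q, hk, rfl⟩ ⟨q', hq⟩
    obtain ⟨rfl, -⟩ := Sigma.mk.inj_iff.1 (Sum.inl_injective hq)
    exact hk.ne rfl
  · exact funext fun i => funext fun j => huv _ ⟨(i, j), rfl⟩

lemma indepFun_layerState_outputWeight :
    IndepFun (fun w => layerState w x y L le_rfl) outputWeight (initLaw d m L) := by
  refine indepFun_layerState x y le_rfl (by unfold outputWeight; fun_prop)
    (t := Set.range Sum.inr) (Set.disjoint_left.2 ?_) fun u v huv => ?_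
  · rintro _ ⟨k, q, -, rfl⟩ ⟨j, hj⟩
    exact Sum.inr_ne_inl hj
  · exact funext fun j => huv _ ⟨j, rfl⟩

end LayerIndependence

section Nondegeneracy

variable {d m L : ℕ} {x : EuclideanSpace ℝ (Fin d)}

lemma embedding_ne_zero_of_le {w : Params d m L} {k l : ℕ} (hkl : k ≤ l) (h : l ≤ L)
    (hl : embedding w x l h ≠ 0) : embedding w x k (hkl.trans h) ≠ 0 := by
  induction l, hkl using Nat.le_induction with
  | base => exact hl
  | succ l _ ih =>
    refine ih (Nat.le_of_succ_le h) fun hzero => hl ?_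
    ext i
    simp [embedding, hzero, relu]

lemma ae_initLaw_hiddenWeight_dotProduct_ne_zero {l : ℕ} (h : l < L) :
    ∀ᵐ w ∂initLaw d m L, embedding w x l h.le ≠ 0 →
      ∀ i, hiddenWeight w ⟨l, h⟩ i ⬝ᵥ embedding w x l h.le ≠ 0 := by
  let B : Set (LayerState (Fin (width d m l)) × (Fin m → Fin (width d m l) → ℝ)) :=
    {q | q.1.1 ≠ 0 ∧ ∃ i, q.2 i ⬝ᵥ q.1.1 = 0}
  have hB : MeasurableSet B := by
    simp only [B, Set.ofPred_and, Set.ofPred_exists]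
    exact (measurableSet_eq_fun (by fun_prop) measurable_const).compl.inter
      (MeasurableSet.iUnion fun i => measurableSet_eq_fun (by fun_prop) measurable_const)
  have hBzero := measure_prodMk_mem_le_of_indepFun (measurable_layerState x x l h.le)
    (measurable_hiddenWeight ⟨l, h⟩) (indepFun_layerState_hiddenWeight (m := m) x x h)
    MeasurableSet.univ hB (c := 0) fun s _ => by
      rw [initLaw_map_hiddenWeight]
      by_cases hs : s.1 = 0
      · simp [B, hs]
      · simpa [B, hs, ae_iff] using ae_gaussMat_forall_dotProduct_ne_zero m hs
  simp only [Set.mem_univ, not_true_eq_false, Set.ofPred_false, measure_empty, add_zero,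
    nonpos_iff_eq_zero] at hBzero
  filter_upwards [measure_eq_zero_iff_ae_notMem.1 hBzero] with w hw hne i hi
  exact hw ⟨hne, i, hi⟩

lemma ae_initLaw_nonzeroPreact :
    ∀ᵐ w ∂initLaw d m L, embedding w x L le_rfl ≠ 0 → NonzeroPreact w x L := by
  filter_upwards [ae_all_iff.2 fun l : Fin L =>
    ae_initLaw_hiddenWeight_dotProduct_ne_zero (x := x) l.isLt] with w hw hL k hk _
  exact hw ⟨k, hk⟩ (embedding_ne_zero_of_le hk.le le_rfl hL)

end Nondegeneracy

section Limit

/-- The limit of the inner product of the `l`-embeddings of two inputs with squared norms `P`, `Q`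
and inner product `R`. -/
def limInner (P Q R : ℝ) : ℕ → ℝ
  | 0 => R
  | l + 1 => nextInner P Q (limInner P Q R l)

/-- The limit of the trace of the matrix of inner products of the gradients of the `l`-embeddings
of two inputs with squared norms `P`, `Q` and inner product `R`. -/
def limTrace (P Q R : ℝ) : ℕ → ℝ
  | 0 => 0
  | l + 1 => nextTrace P Q (limInner P Q R l) (limTrace P Q R l)

/-- The limit of `stateStats` at layer `l`. The squared norms do not depend on the layer, and the
squared Frobenius norm tends to `0`. -/
def limStats (P Q R : ℝ) (l : ℕ) : ℝ × ℝ × ℝ × ℝ × ℝ :=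
  (P, Q, limInner P Q R l, limTrace P Q R l, 0)

variable {d L : ℕ}

lemma dotProduct_ofLp (x y : EuclideanSpace ℝ (Fin d)) :
    (fun k => x k) ⬝ᵥ (fun k => y k) = inner ℝ x y := by
  simp [dotProduct, PiLp.inner_apply, mul_comm]

lemma stateStats_layerState_zero {m : ℕ} (w : Params d m L) (x y : EuclideanSpace ℝ (Fin d))
    (h : 0 ≤ L) :
    stateStats (layerState w x y 0 h) = limStats (‖x‖ ^ 2) (‖y‖ ^ 2) (inner ℝ x y) 0 := by
  rw [layerState_zero]
  simp only [stateStats, limStats, limInner, limTrace, frobSq, Matrix.trace_zero,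
    Matrix.zero_apply, ne_eq, OfNat.ofNat_ne_zero, not_false_eq_true, zero_pow,
    Finset.sum_const_zero, Prod.mk.injEq, and_true]
  exact ⟨(dotProduct_ofLp x x).trans (real_inner_self_eq_norm_sq x),
    (dotProduct_ofLp y y).trans (real_inner_self_eq_norm_sq y), dotProduct_ofLp x y⟩

lemma tendsto_initLaw_prodMk_mem {x y : EuclideanSpace ℝ (Fin d)} {l : ℕ} (h : l ≤ L)
    {z : ℝ × ℝ × ℝ × ℝ × ℝ} (hz : ∀ δ > 0, Tendsto (fun m : ℕ =>
      initLaw d m L {w | δ ≤ dist (stateStats (layerState w x y l h)) z}) atTop (𝓝 0))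
    {β : ℕ → Type*} [∀ m, MeasurableSpace (β m)] {Y : ∀ m, Params d m L → β m}
    (hY : ∀ m, Measurable (Y m))
    (hindep : ∀ m, IndepFun (fun w => layerState w x y l h) (Y m) (initLaw d m L))
    {B : ∀ m, Set (LayerState (Fin (width d m l)) × β m)} (hB : ∀ m, MeasurableSet (B m))
    (hc : ∀ η > 0, ∀ᶠ p : ℕ × (ℝ × ℝ × ℝ × ℝ × ℝ) in atTop ×ˢ 𝓝 z,
      ∀ s : LayerState (Fin (width d p.1 l)), stateStats s = p.2 →
        (initLaw d p.1 L).map (Y p.1) {v | (s, v) ∈ B p.1} ≤ η) :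
    Tendsto (fun m : ℕ => initLaw d m L {w | (layerState w x y l h, Y m w) ∈ B m})
      atTop (𝓝 0) := by
  refine ENNReal.tendsto_nhds_zero.2 fun η hη => ?_
  obtain ⟨_, hwide, _, hnear, hcond⟩ := eventually_prod_iff.1 (hc (η / 2) (ENNReal.half_pos hη.ne'))
  obtain ⟨δ, hδ, hball⟩ := Metric.eventually_nhds_iff.1 hnear
  filter_upwards [hwide, ENNReal.tendsto_nhds_zero.1 (hz δ hδ) (η / 2) (ENNReal.half_pos hη.ne')]
    with m hm hprev
  have hG : MeasurableSet {s : LayerState (Fin (width d m l)) | dist (stateStats s) z < δ} :=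
    measurableSet_lt (measurable_stateStats.dist measurable_const) measurable_const
  have hle := measure_prodMk_mem_le_of_indepFun (measurable_layerState x y l h) (hY m) (hindep m)
    hG (hB m) fun s hs => hcond hm (hball hs) s rfl
  simp only [Set.mem_ofPred_eq, not_lt] at hle
  exact hle.trans ((add_le_add_left hprev _).trans_eq (ENNReal.add_halves η))

variable {x y : EuclideanSpace ℝ (Fin d)}

lemma tendsto_initLaw_dist_stateStats_ge (hx : x ≠ 0) (hy : y ≠ 0) {l : ℕ} (h : l ≤ L) :
    ∀ ε > 0, Tendsto (fun m : ℕ => initLaw d m L {w | ε ≤ dist (stateStats (layerState w x y l h))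
      (limStats (‖x‖ ^ 2) (‖y‖ ^ 2) (inner ℝ x y) l)}) atTop (𝓝 0) := by
  induction l with
  | zero =>
    intro ε hε
    simp [stateStats_layerState_zero, hε.not_ge]
  | succ l ih =>
    intro ε hε
    set z := limStats (‖x‖ ^ 2) (‖y‖ ^ 2) (inner ℝ x y) l
    simp only [layerState_succ]
    refine tendsto_initLaw_prodMk_mem (Nat.le_of_succ_le h) (ih (Nat.le_of_succ_le h))
      (fun m => measurable_hiddenWeight ⟨l, h⟩)
      (fun m => indepFun_layerState_hiddenWeight (m := m) x y h)
      (B := fun m => {q | ε ≤ dist (stateStats (stepState q.2 q.1)) (nextStats z)})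
      (fun m => measurableSet_le measurable_const ((measurable_stateStats.comp
        (measurable_stepState measurable_snd measurable_fst)).dist measurable_const)) fun η hη => ?_
    filter_upwards [eventually_gaussMat_dist_nextStats_ge_le (x := z)
      (pow_pos (norm_pos_iff.2 hx) 2) (pow_pos (norm_pos_iff.2 hy) 2) rfl hε hη] with p hp s hs
    rw [initLaw_map_hiddenWeight]
    exact hp _ s hs

lemma tendsto_initLaw_abs_quadraticForm_sub_trace_ge (hx : x ≠ 0) (hy : y ≠ 0) {ε : ℝ}
    (hε : 0 < ε) :
    Tendsto (fun m : ℕ => initLaw d m L {w | ε ≤ |outputWeight w ⬝ᵥ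
      (layerState w x y L le_rfl).2.2 *ᵥ outputWeight w - (layerState w x y L le_rfl).2.2.trace|})
      atTop (𝓝 0) := by
  refine tendsto_initLaw_prodMk_mem le_rfl (tendsto_initLaw_dist_stateStats_ge hx hy (le_refl L))
    (fun m => by unfold outputWeight; fun_prop)
    (fun m => indepFun_layerState_outputWeight (m := m) x y)
    (B := fun m => {q | ε ≤ |q.2 ⬝ᵥ q.1.2.2 *ᵥ q.2 - q.1.2.2.trace|}) (fun m => ?_) fun η hη => ?_
  · have := measurable_matrix_iff.1 (measurable_fst.snd.snd : Measurable fun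
      q : LayerState (Fin (width d m L)) × (Fin (width d m L) → ℝ) => q.1.2.2)
    simp_rw [dotProduct_mulVec_eq_sum, Matrix.trace, Matrix.diag]
    exact measurableSet_le measurable_const (by fun_prop)
  · have hchebyshev : Continuous fun p : ℝ × ℝ × ℝ × ℝ × ℝ =>
        ENNReal.ofReal (2 * p.2.2.2.2 / ε ^ 2) := ENNReal.continuous_ofReal.comp (by fun_prop)
    filter_upwards [tendsto_snd.eventually ((hchebyshev.tendsto _).eventually_le_const
      (by simpa [limStats] using hη))] with p hp s hs
    rw [initLaw_map_outputWeight]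
    rw [← hs] at hp
    exact (gaussVec_abs_quadraticForm_sub_trace_ge_le s.2.2 hε).trans hp

lemma embedding_ne_zero_of_dist_stateStats_lt {m l : ℕ} {w : Params d m L} {hl : l ≤ L}
    {z : ℝ × ℝ × ℝ × ℝ × ℝ} (h : dist (stateStats (layerState w x y l hl)) z < min z.1 z.2.1) :
    embedding w x l hl ≠ 0 ∧ embedding w y l hl ≠ 0 := by
  simp only [stateStats, layerState, Prod.dist_eq, max_lt_iff, Real.dist_eq, lt_min_iff] at h
  obtain ⟨⟨hx, -⟩, -, hy, -⟩ := h
  constructor <;> intro hzero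
  · rw [hzero, zero_dotProduct, zero_sub, abs_neg] at hx
    exact hx.not_ge (le_abs_self _)
  · rw [hzero, zero_dotProduct, zero_sub, abs_neg] at hy
    exact hy.not_ge (le_abs_self _)

/-- The NTK matrix of the infinitely wide network with `L` hidden layers, as given by the recursions
for the limits of its entries. -/
def limitNTK {n : ℕ} (L : ℕ) (x : Fin n → EuclideanSpace ℝ (Fin d)) : Matrix (Fin n) (Fin n) ℝ :=
  Matrix.of fun i j => limInner (‖x i‖ ^ 2) (‖x j‖ ^ 2) (inner ℝ (x i) (x j)) L
    + limTrace (‖x i‖ ^ 2) (‖x j‖ ^ 2) (inner ℝ (x i) (x j)) L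

lemma isInfiniteWidthNTK_limitNTK {n : ℕ} (L : ℕ) {x : Fin n → EuclideanSpace ℝ (Fin d)}
    (hx : ∀ i, x i ≠ 0) : IsInfiniteWidthNTK L x (limitNTK L x) := by
  intro i j ε hε
  set P := ‖x i‖ ^ 2
  set Q := ‖x j‖ ^ 2
  have hP : 0 < P := pow_pos (norm_pos_iff.2 (hx i)) 2
  have hQ : 0 < Q := pow_pos (norm_pos_iff.2 (hx j)) 2
  let δ := min (ε / 4) (min P Q)
  have hδ : 0 < δ := lt_min (by positivity) (lt_min hP hQ)
  have hstats := tendsto_initLaw_dist_stateStats_ge (hx i) (hx j) (le_refl L) δ hδ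
  have hquad := tendsto_initLaw_abs_quadraticForm_sub_trace_ge (L := L) (hx i) (hx j) (half_pos hε)
  have hsum := hstats.add hquad
  rw [add_zero] at hsum
  refine tendsto_of_tendsto_of_tendsto_of_le_of_le tendsto_const_nhds hsum (fun _ => zero_le)
    fun m => (measure_mono_ae ?_).trans (measure_union_le _ _)
  filter_upwards [ae_initLaw_nonzeroPreact (x := x i), ae_initLaw_nonzeroPreact (x := x j)]
    with w hi hj (hw : ε ≤ _)
  by_contra hnot
  obtain ⟨hdist, hdev⟩ := not_or.1 hnot
  rw [Set.mem_ofPred_eq, not_le] at hdist hdev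
  obtain ⟨hni, hnj⟩ := embedding_ne_zero_of_dist_stateStats_lt (hdist.trans_le (min_le_right _ _))
  refine absurd hw (not_le.2 ?_)
  replace hdist := hdist.trans_le (min_le_left _ _)
  simp only [stateStats, limStats, Prod.dist_eq, max_lt_iff, Real.dist_eq, abs_lt] at hdist hdev
  obtain ⟨-, -, hinner, htrace, -⟩ := hdist
  rw [ntkMatrix_apply (hi hni) (hj hnj), limitNTK, Matrix.of_apply, abs_lt]
  simp only [layerState] at hinner htrace hdev ⊢
  constructor <;> linarith

end Limit

/-! ### The normalized recursion -/

section NormalizedRecursion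

/-- The limit of the cosine of the angle between the `l`-embeddings of two inputs at an angle of
cosine `r`. -/
def cosSeq (r : ℝ) : ℕ → ℝ
  | 0 => r
  | l + 1 => arcCos1 (cosSeq r l)

/-- The limit of the trace in `limTrace` for two unit inputs at an angle of cosine `r`. -/
def traceSeq (r : ℝ) : ℕ → ℝ
  | 0 => 0
  | l + 1 => arcCos0 (cosSeq r l) * (cosSeq r l + traceSeq r l)

/-- The entry of the infinite-width NTK matrix with `l` hidden layers for two unit inputs at an
angle of cosine `r`. -/
def ntkSeq (r : ℝ) (l : ℕ) : ℝ := cosSeq r l + traceSeq r l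

lemma ntkSeq_zero (r : ℝ) : ntkSeq r 0 = r := add_zero r

lemma ntkSeq_succ (r : ℝ) (l : ℕ) :
    ntkSeq r (l + 1) = cosSeq r (l + 1) + arcCos0 (cosSeq r l) * ntkSeq r l := rfl

lemma cosSeq_one (l : ℕ) : cosSeq 1 l = 1 := by
  induction l with
  | zero => rfl
  | succ l ih => rw [cosSeq, ih, arcCos1_one]

lemma ntkSeq_one (l : ℕ) : ntkSeq 1 l = l + 1 := by
  induction l with
  | zero => simp [ntkSeq_zero]
  | succ l ih =>
    rw [ntkSeq_succ, ih, cosSeq_one, cosSeq_one, arcCos0_one]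
    push_cast
    ring

variable {p q : ℝ}

lemma limInner_eq (hp : 0 < p) (hq : 0 < q) (r : ℝ) (l : ℕ) :
    limInner (p ^ 2) (q ^ 2) (p * q * r) l = p * q * cosSeq r l := by
  induction l with
  | zero => rfl
  | succ l ih =>
    rw [limInner, ih, nextInner, Real.sqrt_sq hp.le, Real.sqrt_sq hq.le, cosSeq,
      mul_div_cancel_left₀ _ (mul_pos hp hq).ne']

lemma limTrace_eq (hp : 0 < p) (hq : 0 < q) (r : ℝ) (l : ℕ) :
    limTrace (p ^ 2) (q ^ 2) (p * q * r) l = p * q * traceSeq r l := by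
  induction l with
  | zero => simp only [limTrace, traceSeq, mul_zero]
  | succ l ih =>
    rw [limTrace, ih, limInner_eq hp hq, nextTrace, Real.sqrt_sq hp.le, Real.sqrt_sq hq.le,
      traceSeq, mul_div_cancel_left₀ _ (mul_pos hp hq).ne']
    ring

end NormalizedRecursion

section SmallAngle

variable {φ : ℝ}

lemma arcCos1_cos (h0 : 0 ≤ φ) (hπ : φ ≤ π) :
    arcCos1 (Real.cos φ) = Real.cos φ + (Real.sin φ - φ * Real.cos φ) / π := by
  rw [arcCos1, Real.arccos_cos h0 hπ]
  field_simp
  ring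

lemma cos_le_arcCos1_cos (h0 : 0 ≤ φ) (hφ : φ < π / 2) : Real.cos φ ≤ arcCos1 (Real.cos φ) := by
  have hcos : 0 < Real.cos φ := Real.cos_pos_of_mem_Ioo ⟨by linarith, hφ⟩
  have htan := Real.le_tan h0 hφ
  rw [Real.tan_eq_sin_div_cos, le_div_iff₀ hcos] at htan
  rw [arcCos1_cos h0 (by linarith)]
  exact le_add_of_nonneg_right (div_nonneg (sub_nonneg.2 htan) Real.pi_pos.le)

lemma sin_sub_mul_cos_le (h0 : 0 ≤ φ) : Real.sin φ - φ * Real.cos φ ≤ φ ^ 3 / 2 := by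
  have hcos := mul_le_mul_of_nonneg_left (Real.one_sub_sq_div_two_le_cos (x := φ)) h0
  linarith [Real.sin_le h0]

lemma arcCos1_cos_le (h0 : 0 ≤ φ) (h1 : φ ≤ 1 / 4) :
    arcCos1 (Real.cos φ) ≤ Real.cos (φ - φ ^ 2) := by
  have hπ := Real.pi_gt_three
  have hsq : φ ^ 2 ≤ φ / 4 := by nlinarith
  suffices φ ^ 3 / 2 / π ≤ Real.cos (φ - φ ^ 2) - Real.cos φ by
    have := div_le_div_of_nonneg_right (sin_sub_mul_cos_le h0) Real.pi_pos.le
    rw [arcCos1_cos h0 (by linarith)]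
    linarith
  calc φ ^ 3 / 2 / π ≤ 4 * (φ ^ 3 * (1 - φ / 2)) / π / π := by
        refine div_le_div_of_nonneg_right ((le_div_iff₀ Real.pi_pos).2 ?_) Real.pi_pos.le
        nlinarith [Real.pi_le_four, pow_nonneg h0 3]
    _ = 2 * (2 / π * (φ - φ ^ 2 / 2)) * (2 / π * (φ ^ 2 / 2)) := by ring
    _ ≤ 2 * Real.sin (φ - φ ^ 2 / 2) * Real.sin (φ ^ 2 / 2) := by
        gcongr
        · exact mul_nonneg two_pos.le
            (Real.sin_nonneg_of_nonneg_of_le_pi (by linarith) (by linarith [sq_nonneg φ]))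
        · exact Real.mul_le_sin (by linarith) (by linarith [sq_nonneg φ])
        · exact Real.mul_le_sin (by positivity) (by linarith)
    _ = Real.cos (φ - φ ^ 2) - Real.cos φ := by
        rw [Real.cos_sub_cos, show (φ - φ ^ 2 + φ) / 2 = φ - φ ^ 2 / 2 by ring,
          show (φ - φ ^ 2 - φ) / 2 = -(φ ^ 2 / 2) by ring, Real.sin_neg]
        ring

lemma exists_arcCos1_cos_eq_cos (h0 : 0 ≤ φ) (h1 : φ ≤ 1 / 4) :
    ∃ ψ ∈ Set.Icc (φ - φ ^ 2) φ, Real.cos ψ = arcCos1 (Real.cos φ) :=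
  intermediate_value_Icc' (sub_le_self φ (sq_nonneg φ)) Real.continuous_cos.continuousOn
    ⟨cos_le_arcCos1_cos h0 (by linarith [Real.pi_gt_three]), arcCos1_cos_le h0 h1⟩

variable {θ : ℝ} {l : ℕ}

lemma exists_cosSeq_eq_cos (h0 : 0 ≤ θ) (h1 : θ ≤ 1 / 4) (hl : l * θ ≤ 1) :
    ∃ φ ∈ Set.Icc (θ - l * θ ^ 2) θ, Real.cos φ = cosSeq (Real.cos θ) l := by
  induction l with
  | zero => exact ⟨θ, by simp, rfl⟩
  | succ l ih =>
    push_cast at hl ⊢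
    obtain ⟨φ, ⟨hlo, hhi⟩, hcos⟩ := ih (by linarith)
    have hφ0 : 0 ≤ φ := by nlinarith
    obtain ⟨ψ, ⟨hψlo, hψhi⟩, hψ⟩ := exists_arcCos1_cos_eq_cos hφ0 (hhi.trans h1)
    refine ⟨ψ, ⟨?_, hψhi.trans hhi⟩, by rw [hψ, hcos, cosSeq]⟩
    have hsq : φ ^ 2 ≤ θ ^ 2 := pow_le_pow_left₀ hφ0 hhi 2
    linarith

lemma cosSeq_mem_Icc (h0 : 0 ≤ θ) (h1 : θ ≤ 1 / 4) (hl : l * θ ≤ 1) :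
    cosSeq (Real.cos θ) l ∈ Set.Icc (Real.cos θ) 1 := by
  obtain ⟨φ, ⟨hlo, hhi⟩, hcos⟩ := exists_cosSeq_eq_cos h0 h1 hl
  rw [← hcos]
  refine ⟨Real.cos_le_cos_of_nonneg_of_le_pi ?_ ?_ hhi, Real.cos_le_one φ⟩
  · nlinarith
  · linarith [Real.pi_gt_three]

lemma arcCos0_cosSeq_mem_Icc (h0 : 0 ≤ θ) (h1 : θ ≤ 1 / 4) (hl : l * θ ≤ 1) :
    arcCos0 (cosSeq (Real.cos θ) l) ∈ Set.Icc (1 - θ / π) (1 - (θ - l * θ ^ 2) / π) := by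
  obtain ⟨φ, ⟨hlo, hhi⟩, hcos⟩ := exists_cosSeq_eq_cos h0 h1 hl
  have hφ0 : 0 ≤ φ := by nlinarith
  rw [← hcos, arcCos0, Real.arccos_cos hφ0 (by linarith [Real.pi_gt_three])]
  constructor <;> gcongr

/-- The cosine of the infinite-width NTK with `l` hidden layers for two inputs at angle `θ`: the
diagonal entries for unit inputs are `l + 1`, by `ntkSeq_one`. -/
def ntkCos (θ : ℝ) (l : ℕ) : ℝ := ntkSeq (Real.cos θ) l / (l + 1)

lemma ntkCos_zero (θ : ℝ) : ntkCos θ 0 = Real.cos θ := by simp [ntkCos, ntkSeq_zero]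

lemma one_sub_div_le_cos (h0 : 0 ≤ θ) (h1 : θ ≤ 1 / 4) : 1 - θ / (2 * π) ≤ Real.cos θ := by
  have hsq : θ ^ 2 / 2 ≤ θ / (2 * π) := by
    rw [div_le_div_iff₀ two_pos Real.two_pi_pos]
    nlinarith [Real.pi_le_four, Real.pi_pos, mul_nonneg h0 Real.pi_pos.le]
  linarith [Real.one_sub_sq_div_two_le_cos (x := θ)]

lemma ntkSeq_nonneg (h0 : 0 ≤ θ) (h1 : θ ≤ 1 / 4) (hl : l * θ ≤ 1) :
    0 ≤ ntkSeq (Real.cos θ) l := by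
  have hcos : 0 ≤ Real.cos θ := Real.cos_nonneg_of_mem_Icc
    ⟨by linarith [Real.pi_gt_three], by linarith [Real.pi_gt_three]⟩
  induction l with
  | zero => rwa [ntkSeq_zero]
  | succ l ih =>
    have hl' : l * θ ≤ 1 := by push_cast at hl; linarith
    rw [ntkSeq_succ]
    exact add_nonneg (hcos.trans (cosSeq_mem_Icc h0 h1 hl).1)
      (mul_nonneg (arcCos0_nonneg _) (ih hl'))

lemma ntkSeq_le (h0 : 0 ≤ θ) (h1 : θ ≤ 1 / 4) (hl : l * θ ≤ 1) :
    ntkSeq (Real.cos θ) l ≤ l + 1 := by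
  induction l with
  | zero => simpa only [ntkSeq_zero, Nat.cast_zero, zero_add] using Real.cos_le_one θ
  | succ l ih =>
    have hl' : l * θ ≤ 1 := by push_cast at hl; linarith
    have hmul := mul_le_of_le_one_left (ntkSeq_nonneg h0 h1 hl')
      (arcCos0_le_one (cosSeq (Real.cos θ) l))
    rw [ntkSeq_succ]
    push_cast
    linarith [ih hl', (cosSeq_mem_Icc h0 h1 hl).2]

lemma le_ntkSeq (h0 : 0 ≤ θ) (h1 : θ ≤ 1 / 4) (hl : l * θ ≤ 1) :
    (l + 1) - (l + 1) ^ 2 * (θ / (2 * π)) ≤ ntkSeq (Real.cos θ) l := by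
  have hcos := one_sub_div_le_cos h0 h1
  induction l with
  | zero => simpa [ntkSeq_zero] using hcos
  | succ l ih =>
    have hl' : l * θ ≤ 1 := by push_cast at hl; linarith
    have hmul := mul_le_mul_of_nonneg_right (arcCos0_cosSeq_mem_Icc h0 h1 hl').1
      (ntkSeq_nonneg h0 h1 hl')
    have hle := mul_le_mul_of_nonneg_left (ntkSeq_le h0 h1 hl') (div_nonneg h0 Real.pi_pos.le)
    have htwo : θ / π = 2 * (θ / (2 * π)) := by ring
    rw [htwo] at hmul hle
    rw [ntkSeq_succ]
    push_cast
    linarith [ih hl', (cosSeq_mem_Icc h0 h1 hl).1]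

lemma ntkCos_succ_lt (h0 : 0 < θ) (hl : (l + 1) * θ ≤ 1 / 4) :
    ntkCos θ (l + 1) < ntkCos θ l := by
  set u := θ / (2 * π) with hu
  set n : ℝ := l + 1 with hn
  set K := ntkSeq (Real.cos θ) l with hK
  have hn1 : 1 ≤ n := by simp [hn]
  have hlθ : l * θ ≤ 1 / 4 := by linarith
  have h1 : θ ≤ 1 / 4 := by nlinarith
  have hu0 : 0 < u := by positivity
  have hnu : n * u < 1 / 3 := by
    rw [hu, ← mul_div_assoc, div_lt_iff₀ Real.two_pi_pos]
    linarith [Real.pi_gt_three]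
  have hlow : n - n ^ 2 * u ≤ K := le_ntkSeq h0.le h1 (by linarith)
  have hcos : cosSeq (Real.cos θ) (l + 1) ≤ 1 :=
    (cosSeq_mem_Icc h0.le h1 (by push_cast; linarith)).2
  have hderiv : arcCos0 (cosSeq (Real.cos θ) l) ≤ 1 - 3 / 2 * u := by
    refine (arcCos0_cosSeq_mem_Icc h0.le h1 (by linarith)).2.trans ?_
    have hquad : 3 / 4 * θ ≤ θ - l * θ ^ 2 := by
      linarith [mul_le_mul_of_nonneg_right hlθ h0.le]
    rw [show 3 / 2 * u = 3 / 4 * θ / π by rw [hu]; ring]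
    exact sub_le_sub_left (div_le_div_of_nonneg_right hquad Real.pi_pos.le) 1
  have hmul := mul_le_mul_of_nonneg_right hderiv (ntkSeq_nonneg h0.le h1 (by linarith))
  have hgain : n < K * (1 + 3 / 2 * (n * u)) := calc
    n < n * ((1 - n * u) * (1 + 3 / 2 * (n * u))) :=
      lt_mul_of_one_lt_right (by linarith) (by nlinarith [mul_pos (zero_lt_one.trans_le hn1) hu0])
    _ = (n - n ^ 2 * u) * (1 + 3 / 2 * (n * u)) := by ring
    _ ≤ K * (1 + 3 / 2 * (n * u)) := by gcongr
  rw [ntkCos, ntkCos, ntkSeq_succ, Nat.cast_succ, ← hn, ← hK,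
    div_lt_div_iff₀ (by linarith) (by linarith)]
  nlinarith

lemma strictAntiOn_ntkCos (h0 : 0 < θ) : StrictAntiOn (ntkCos θ) {l : ℕ | l * θ ≤ 1 / 4} := by
  have hlower : IsLowerSet {l : ℕ | l * θ ≤ 1 / 4} := fun a b hba (ha : a * θ ≤ 1 / 4) =>
    (mul_le_mul_of_nonneg_right (Nat.cast_le.2 hba) h0.le).trans ha
  refine strictAntiOn_of_add_one_lt hlower.ordConnected fun l _ _ hl => ntkCos_succ_lt h0 ?_
  rwa [Set.mem_ofPred_eq, Nat.cast_add_one] at hl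

lemma ntkCos_nonneg (h0 : 0 ≤ θ) (h1 : θ ≤ 1 / 4) (hl : l * θ ≤ 1) : 0 ≤ ntkCos θ l :=
  div_nonneg (ntkSeq_nonneg h0 h1 hl) (by positivity)

lemma ntkCos_lt_one (h0 : 0 < θ) (hθ : θ ≤ π) (hl : l * θ ≤ 1 / 4) : ntkCos θ l < 1 := by
  have hzero : (0 : ℕ) * θ ≤ 1 / 4 := by norm_num
  refine ((strictAntiOn_ntkCos h0).antitoneOn hzero hl (Nat.zero_le l)).trans_lt ?_
  rw [ntkCos_zero, ← Real.cos_zero]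
  exact Real.cos_lt_cos_of_nonneg_of_le_pi le_rfl hθ h0

end SmallAngle

/-! ### Condition numbers -/

/-- The Gram matrix of two vectors of norms `√s p`, `√s q` at an angle of cosine `ρ`. -/
def pairMatrix (s p q ρ : ℝ) : Matrix (Fin 2) (Fin 2) ℝ :=
  !![s * p ^ 2, s * (p * q * ρ); s * (p * q * ρ), s * q ^ 2]

/-- The gap between the eigenvalues of `pairMatrix 1 p q ρ`. -/
def eigenGap (p q ρ : ℝ) : ℝ := √((p ^ 2 - q ^ 2) ^ 2 + 4 * (p * q * ρ) ^ 2)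

section PairMatrix

variable {s s' p q ρ ρ' : ℝ}

lemma spectrum_pairMatrix (s p q ρ : ℝ) :
    spectrum ℝ (pairMatrix s p q ρ) =
      {s * ((p ^ 2 + q ^ 2 - eigenGap p q ρ) / 2), s * ((p ^ 2 + q ^ 2 + eigenGap p q ρ) / 2)} := by
  ext μ
  have hgap : eigenGap p q ρ ^ 2 = (p ^ 2 - q ^ 2) ^ 2 + 4 * (p * q * ρ) ^ 2 :=
    Real.sq_sqrt (by positivity)
  have hdet : (algebraMap ℝ (Matrix (Fin 2) (Fin 2) ℝ) μ - pairMatrix s p q ρ).det =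
      (μ - s * ((p ^ 2 + q ^ 2 - eigenGap p q ρ) / 2)) *
        (μ - s * ((p ^ 2 + q ^ 2 + eigenGap p q ρ) / 2)) := by
    rw [pairMatrix, Matrix.algebraMap_eq_diagonal, Matrix.det_fin_two]
    simp only [Matrix.sub_apply, Matrix.diagonal_apply_eq, Matrix.of_apply, Matrix.cons_val',
      Matrix.cons_val_zero, Matrix.cons_val_one, Matrix.cons_val_fin_one, Pi.algebraMap_apply,
      Algebra.algebraMap_self_apply, Matrix.diagonal_apply_ne _ (zero_ne_one' (Fin 2)),
      Matrix.diagonal_apply_ne _ (one_ne_zero' (Fin 2))]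
    linear_combination (s ^ 2 / 4) * hgap
  rw [spectrum.mem_iff, Matrix.isUnit_iff_isUnit_det, isUnit_iff_ne_zero, not_not, hdet,
    mul_eq_zero, sub_eq_zero, sub_eq_zero, Set.mem_insert_iff, Set.mem_singleton_iff]

lemma eigenGap_lt_eigenGap (hp : 0 < p) (hq : 0 < q) (h0 : 0 ≤ ρ) (h : ρ < ρ') :
    eigenGap p q ρ < eigenGap p q ρ' := by
  have hsq : (p * q * ρ) ^ 2 < (p * q * ρ') ^ 2 := by gcongr
  exact Real.sqrt_lt_sqrt (by positivity) (by linarith)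

lemma eigenGap_one (p q : ℝ) : eigenGap p q 1 = p ^ 2 + q ^ 2 := by
  rw [eigenGap, Real.sqrt_eq_iff_mul_self_eq (by positivity) (by positivity)]
  ring

lemma eigenGap_lt (hp : 0 < p) (hq : 0 < q) (h0 : 0 ≤ ρ) (h1 : ρ < 1) :
    eigenGap p q ρ < p ^ 2 + q ^ 2 :=
  eigenGap_one p q ▸ eigenGap_lt_eigenGap hp hq h0 h1

lemma posDef_pairMatrix (hs : 0 < s) (hp : 0 < p) (hq : 0 < q) (h0 : 0 ≤ ρ) (h1 : ρ < 1) :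
    (pairMatrix s p q ρ).PosDef := by
  have hsymm : (pairMatrix s p q ρ).IsHermitian := by
    ext i j
    fin_cases i <;> fin_cases j <;> rfl
  have hgap := eigenGap_lt hp hq h0 h1
  have hgap0 : 0 ≤ eigenGap p q ρ := Real.sqrt_nonneg _
  refine hsymm.posDef_iff_eigenvalues_pos.2 fun i => ?_
  have hmem := hsymm.eigenvalues_mem_spectrum_real i
  rw [spectrum_pairMatrix] at hmem
  rcases hmem with hi | hi <;> rw [hi] <;> exact mul_pos hs (by linarith)

lemma conditionNumber_pairMatrix (hs : 0 < s) (p q ρ : ℝ) :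
    conditionNumber (pairMatrix s p q ρ) =
      (p ^ 2 + q ^ 2 + eigenGap p q ρ) / (p ^ 2 + q ^ 2 - eigenGap p q ρ) := by
  have hgap : 0 ≤ eigenGap p q ρ := Real.sqrt_nonneg _
  have hle : s * ((p ^ 2 + q ^ 2 - eigenGap p q ρ) / 2) ≤
      s * ((p ^ 2 + q ^ 2 + eigenGap p q ρ) / 2) :=
    mul_le_mul_of_nonneg_left (by linarith) hs.le
  rw [conditionNumber, spectrum_pairMatrix, csSup_pair, csInf_pair, sup_eq_right.2 hle,
    inf_eq_left.2 hle, mul_div_mul_left _ _ hs.ne', div_div_div_cancel_right₀ two_ne_zero]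

lemma conditionNumber_pairMatrix_lt (hs : 0 < s) (hs' : 0 < s') (hp : 0 < p) (hq : 0 < q)
    (h0 : 0 ≤ ρ) (hρ : ρ < ρ') (h1 : ρ' < 1) :
    conditionNumber (pairMatrix s p q ρ) < conditionNumber (pairMatrix s' p q ρ') := by
  have hgap := eigenGap_lt_eigenGap hp hq h0 hρ
  have hgap' := eigenGap_lt hp hq (h0.trans hρ.le) h1
  rw [conditionNumber_pairMatrix hs, conditionNumber_pairMatrix hs']
  exact div_lt_div₀ (by linarith) (by linarith)
    (add_nonneg (by positivity) (Real.sqrt_nonneg _)) (by linarith)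

end PairMatrix

section LimitNTK

variable {d n : ℕ}

lemma limitNTK_zero (x : Fin n → EuclideanSpace ℝ (Fin d)) : limitNTK 0 x = gramMatrix x := by
  ext i j
  simp [limitNTK, limInner, limTrace, gramMatrix, featureMatrix, Matrix.mul_apply,
    PiLp.inner_apply, mul_comm]

lemma limitNTK_apply {x : Fin n → EuclideanSpace ℝ (Fin d)} {i j : Fin n} (hi : x i ≠ 0)
    (hj : x j ≠ 0) (L : ℕ) :
    limitNTK L x i j =
      ‖x i‖ * ‖x j‖ * ntkSeq (Real.cos (InnerProductGeometry.angle (x i) (x j))) L := by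
  have hinner : inner ℝ (x i) (x j) =
      ‖x i‖ * ‖x j‖ * Real.cos (InnerProductGeometry.angle (x i) (x j)) := by
    rw [← InnerProductGeometry.cos_angle_mul_norm_mul_norm, mul_comm]
  rw [limitNTK, Matrix.of_apply, hinner, limInner_eq (norm_pos_iff.2 hi) (norm_pos_iff.2 hj),
    limTrace_eq (norm_pos_iff.2 hi) (norm_pos_iff.2 hj), ← mul_add, ntkSeq]

lemma limitNTK_apply_self {x : Fin n → EuclideanSpace ℝ (Fin d)} {i : Fin n} (hi : x i ≠ 0)
    (L : ℕ) : limitNTK L x i i = (L + 1) * ‖x i‖ ^ 2 := by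
  rw [limitNTK_apply hi hi, InnerProductGeometry.angle_self hi, Real.cos_zero, ntkSeq_one]
  ring

variable {x : Fin 2 → EuclideanSpace ℝ (Fin d)}

lemma limitNTK_eq_pairMatrix (h0 : x 0 ≠ 0) (h1 : x 1 ≠ 0) (L : ℕ) :
    limitNTK L x =
      pairMatrix (L + 1) ‖x 0‖ ‖x 1‖ (ntkCos (InnerProductGeometry.angle (x 0) (x 1)) L) := by
  have hsymm : limitNTK L x 1 0 = limitNTK L x 0 1 := by
    rw [limitNTK_apply h0 h1, limitNTK_apply h1 h0, InnerProductGeometry.angle_comm,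
      mul_comm ‖x 1‖]
  have hoff : limitNTK L x 0 1 =
      (L + 1) * (‖x 0‖ * ‖x 1‖ * ntkCos (InnerProductGeometry.angle (x 0) (x 1)) L) := by
    rw [limitNTK_apply h0 h1, ntkCos]
    field_simp
  rw [Matrix.eta_fin_two (limitNTK L x), hsymm, hoff, limitNTK_apply_self h0,
    limitNTK_apply_self h1, pairMatrix]

lemma posDef_limitNTK {L : ℕ} (h0 : x 0 ≠ 0) (h1 : x 1 ≠ 0)
    (hpos : 0 < InnerProductGeometry.angle (x 0) (x 1))
    (hle : InnerProductGeometry.angle (x 0) (x 1) ≤ 1 / 4)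
    (hL : L * InnerProductGeometry.angle (x 0) (x 1) ≤ 1 / 4) : (limitNTK L x).PosDef := by
  rw [limitNTK_eq_pairMatrix h0 h1]
  exact posDef_pairMatrix (by positivity) (norm_pos_iff.2 h0) (norm_pos_iff.2 h1)
    (ntkCos_nonneg hpos.le hle (by linarith))
    (ntkCos_lt_one hpos (InnerProductGeometry.angle_le_pi _ _) hL)

lemma strictAntiOn_conditionNumber_limitNTK (h0 : x 0 ≠ 0) (h1 : x 1 ≠ 0)
    (hpos : 0 < InnerProductGeometry.angle (x 0) (x 1))
    (hle : InnerProductGeometry.angle (x 0) (x 1) ≤ 1 / 4) :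
    StrictAntiOn (fun L => conditionNumber (limitNTK L x))
      {L : ℕ | L * InnerProductGeometry.angle (x 0) (x 1) ≤ 1 / 4} := by
  intro L₂ hL₂ L₁ hL₁ hlt
  have hL₁' : L₁ * InnerProductGeometry.angle (x 0) (x 1) ≤ 1 / 4 := hL₁
  simp only [limitNTK_eq_pairMatrix h0 h1]
  exact conditionNumber_pairMatrix_lt (by positivity) (by positivity) (norm_pos_iff.2 h0)
    (norm_pos_iff.2 h1) (ntkCos_nonneg hpos.le hle (by linarith))
    (strictAntiOn_ntkCos hpos hL₂ hL₁ hlt)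
    (ntkCos_lt_one hpos (InnerProductGeometry.angle_le_pi _ _) hL₂)

end LimitNTK

lemma mul_le_and_le_of_le_div {c θ : ℝ} {L : ℕ} (hc : 0 ≤ c) (hL : 1 ≤ L) (h : θ ≤ c / L) :
    L * θ ≤ c ∧ θ ≤ c :=
  ⟨(le_div_iff₀' (Nat.cast_pos.2 hL)).1 h, h.trans (div_le_self hc (Nat.one_le_cast.2 hL))⟩

end DeepReLU

end

theorem mainTheorem2 :
    ∃ c : ℝ, 0 < c ∧
      ∀ (d : ℕ) (x : Fin 2 → EuclideanSpace ℝ (Fin d)),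
        x 0 ≠ 0 → x 1 ≠ 0 → 0 < InnerProductGeometry.angle (x 0) (x 1) →
        (∀ L : ℕ, 1 ≤ L → InnerProductGeometry.angle (x 0) (x 1) ≤ c / (L : ℝ) →
          (DeepReLU.gramMatrix x).PosDef ∧
          ∃ K : Matrix (Fin 2) (Fin 2) ℝ,
            DeepReLU.IsInfiniteWidthNTK L x K ∧ K.PosDef ∧
            DeepReLU.conditionNumber K < DeepReLU.conditionNumber (DeepReLU.gramMatrix x)) ∧
        (∀ L₁ L₂ : ℕ, 1 ≤ L₂ → L₂ < L₁ →
          InnerProductGeometry.angle (x 0) (x 1) ≤ c / (L₁ : ℝ) →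
          ∃ K₁ K₂ : Matrix (Fin 2) (Fin 2) ℝ,
            DeepReLU.IsInfiniteWidthNTK L₁ x K₁ ∧ DeepReLU.IsInfiniteWidthNTK L₂ x K₂ ∧
            K₁.PosDef ∧ K₂.PosDef ∧
            DeepReLU.conditionNumber K₁ < DeepReLU.conditionNumber K₂) := by
  refine ⟨1 / 4, by norm_num, fun d x h0 h1 hpos => ?_⟩
  have hx : ∀ i, x i ≠ 0 := Fin.forall_fin_two.2 ⟨h0, h1⟩
  refine ⟨fun L hL h => ?_, fun L₁ L₂ hL₂ hlt h => ?_⟩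
  · obtain ⟨hmul, hle⟩ := DeepReLU.mul_le_and_le_of_le_div (by norm_num) hL h
    have hzero : (0 : ℕ) * InnerProductGeometry.angle (x 0) (x 1) ≤ 1 / 4 := by norm_num
    rw [← DeepReLU.limitNTK_zero]
    exact ⟨DeepReLU.posDef_limitNTK h0 h1 hpos hle hzero, DeepReLU.limitNTK L x,
      DeepReLU.isInfiniteWidthNTK_limitNTK L hx, DeepReLU.posDef_limitNTK h0 h1 hpos hle hmul,
      DeepReLU.strictAntiOn_conditionNumber_limitNTK h0 h1 hpos hle hzero hmul hL⟩
  · obtain ⟨hmul₁, hle⟩ :=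
      DeepReLU.mul_le_and_le_of_le_div (by norm_num) (hL₂.trans hlt.le) h
    have hmul₂ : L₂ * InnerProductGeometry.angle (x 0) (x 1) ≤ 1 / 4 :=
      (mul_le_mul_of_nonneg_right (Nat.cast_le.2 hlt.le) hpos.le).trans hmul₁
    exact ⟨DeepReLU.limitNTK L₁ x, DeepReLU.limitNTK L₂ x,
      DeepReLU.isInfiniteWidthNTK_limitNTK L₁ hx, DeepReLU.isInfiniteWidthNTK_limitNTK L₂ hx,
      DeepReLU.posDef_limitNTK h0 h1 hpos hle hmul₁, DeepReLU.posDef_limitNTK h0 h1 hpos hle hmul₂,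
      DeepReLU.strictAntiOn_conditionNumber_limitNTK h0 h1 hpos hle hmul₂ hmul₁ hlt⟩
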